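/- **Setting.** Let $X$ be a real random variable with mean $\mu$, finite variance $\sigma_X^2$ and absolutely continuous distribution. Let $\mathcal G=(\mathcal V,\mathcal E)$ be a finite connected undirected graph of $m$ agents, let $\mathcal N_i$ be the set of neighbours of $i$ together with $i$, and let $\lambda$ be the second largest eigenvalue of the Perron matrix $P=(I+D)^{-1}(I+A)$ ($D$ degree matrix, $A$ adjacency matrix; $\lambda:=0$ if $m=1$). Let $\eta\in(0,1/16)$, $\delta\in(0,1)$ and $K\in\{0,1,2,\dots\}$. At each time $t=1,2,\dots$ every agent $i$ draws two samples $x_{i,t},y_{i,t}$, all of them (over $i$ and $t$) being i.i.d. copies of $X$. An adversary who sees all samples replaces them by arbitrary values $\tilde x_{i,t},\tilde y_{i,t}$ such that, for every agent $i$ and every $t\ge1$, at most $2\eta t$ of the $2t$ samples of agent $i$ up to time $t$ are changed. Fix an (arbitrarily or randomly chosen) agent $o$. **Algorithm.** Put $\epsilon_t=8\eta+12\log(4/\delta)/t$. Let $\tilde y^*_{o,1}\le\dots\le\tilde y^*_{o,t}$ be the sorted values $\tilde y_{o,1},\dots,\tilde y_{o,t}$, and let $\alpha_{o,t}=\tilde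 y^*_{o,\epsilon_t t}$, $\beta_{o,t}=\tilde y^*_{o,(1-\epsilon_t)t}$ (ranks are rounded up to integers, and then replaced by the nearest rank in $\{1,\dots,t\}$). Let $\phi_{\alpha,\beta}(x)=\beta$ if $x>\beta$, and otherwise $\phi_{\alpha,\beta}(x)=\alpha$ if $x<\alpha$ and $\phi_{\alpha,\beta}(x)=x$ if $x\ge\alpha$. Starting from $\hat\mu_{i,0}^K=0$, for $t\ge1$ every agent computes $$\hat\mu_{i,t}^0=\frac{(t-1)\hat\mu_{i,t-1}^K+\phi_{\alpha_{o,t},\beta_{o,t}}(\tilde x_{i,t})}{t},\qquad \hat\mu_{i,t}^{k+1}=\frac1{|\mathcal N_i|}\sum_{j\in\mathcal N_i}\hat\mu_{j,t}^k\quad(0\le k<K).$$ Let $\tilde\mu_t=\frac1m\sum_{i\in\mathcal V}\hat\mu^0_{i,t}$ be the group decision value. **Theorem.** There is a constant $c>0$, depending only on the graph $\mathcal G$, such that almost surely there exists a finite (sample path dependent) time $\bar t\ge1$ such that for all $t\ge\bar t+1$ and all agents $i\in\mathcal V$ $$|\hat\mu_{i,t}^K-\mu|\le (c\lambda^K)^{t-\bar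 t}\,|\hat\mu_{i,\bar t}^K-\tilde\mu_{\bar t}|+\sum_{j=\bar t+1}^t (c\lambda^K)^{t+1-j}\,\frac{2\max(|\alpha_{o,j}|,|\beta_{o,j}|)}{j}+\frac{\bar t}{t}\,|\tilde\mu_{\bar t}-\mu|+\frac1t\sum_{j=\bar t+1}^t\frac{\sigma_X}{\sqrt{4\eta+6\log(4/\delta)/j}},$$ where $\lambda^0=1$. -/

import Mathlib

open MeasureTheory ProbabilityTheory

noncomputable section

namespace RobustMean

/-! ### Trimmed mean estimation from one path of data (time steps are `1, 2, 3, …`) -/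

/-- The level `ε_t = 8 η + 12 log (4 / δ) / t`. -/
def eps (η δ : ℝ) (t : ℕ) : ℝ := 8 * η + 12 * (Real.log (4 / δ) / t)

/-- The non-decreasing rearrangement of `y 1, …, y t`. -/
def sortedSample (y : ℕ → ℝ) (t : ℕ) : Fin t → ℝ :=
  (fun j : Fin t => y (j + 1)) ∘ Tuple.sort (fun j : Fin t => y (j + 1))

/-- The order statistic of rank `r` (counted from `1`) of `y 1, …, y t`. The real rank `r` is
rounded up to an integer and a rank outside `{1, …, t}` is replaced by the nearest one in it. -/
def orderStat (y : ℕ → ℝ) (t : ℕ) (r : ℝ) : ℝ :=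
  if h : 0 < t then sortedSample y t ⟨min (⌈r⌉₊ - 1) (t - 1), by omega⟩ else 0

/-- The lower trimming value at time `t`. -/
def lowerTrim (η δ : ℝ) (y : ℕ → ℝ) (t : ℕ) : ℝ := orderStat y t (eps η δ t * t)

/-- The upper trimming value at time `t`. -/
def upperTrim (η δ : ℝ) (y : ℕ → ℝ) (t : ℕ) : ℝ := orderStat y t ((1 - eps η δ t) * t)

/-- The trimming function `φ_{α,β}`. -/
def trim (α β x : ℝ) : ℝ := if x > β then β else if x < α then α else x

/-- Of the `2 t` samples of an agent up to time `t`, at most `2 η t` are corrupted, for all `t`.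
Here `x, y` are the two original streams and `xc, yc` the corrupted ones. -/
def IsCorruption (η : ℝ) (x y xc yc : ℕ → ℝ) : Prop :=
  ∀ t : ℕ, 1 ≤ t →
    (((Finset.Icc 1 t).filter (fun j => xc j ≠ x j)).card : ℝ)
      + (((Finset.Icc 1 t).filter (fun j => yc j ≠ y j)).card : ℝ) ≤ 2 * η * t

/-! ### The network -/

variable {V : Type*} [Fintype V] [DecidableEq V]

/-- One round of communication: every agent averages over its inclusive neighbourhood. -/
def commRound (G : SimpleGraph V) [DecidableRel G.Adj] (v : V → ℝ) (i : V) : ℝ :=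
  (∑ j ∈ insert i (G.neighborFinset i), v j) / ((insert i (G.neighborFinset i)).card : ℝ)

/-- The Perron matrix `(I + D)⁻¹ (I + A)`. -/
def perronMatrix (G : SimpleGraph V) [DecidableRel G.Adj] : Matrix V V ℝ :=
  (1 + G.degMatrix ℝ)⁻¹ * (1 + G.adjMatrix ℝ)

/-- The second largest eigenvalue of the Perron matrix of a connected graph. The largest one is
`1` and it is simple, so that the second largest one is the largest one different from `1`.
(It is `0` for a complete graph, and by convention `0` if there is only one agent.) -/
def secondEigenvalue (G : SimpleGraph V) [DecidableRel G.Adj] : ℝ :=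
  sSup {θ : ℝ | Module.End.HasEigenvalue (Matrix.toLin' (perronMatrix G)) θ ∧ θ ≠ 1}

/-- The local update at time `t`: from the estimates `prev` at the end of step `t - 1`, the
estimates at time `t` before communication. All agents use the trimming values of agent `o`. -/
def localUpdate (η δ : ℝ) (o : V) (xc yc : V → ℕ → ℝ) (t : ℕ) (prev : V → ℝ) (i : V) : ℝ :=
  (((t : ℝ) - 1) * prev i
    + trim (lowerTrim η δ (yc o) t) (upperTrim η δ (yc o) t) (xc i t)) / t

/-- The estimates of all agents at the end of time step `t`, after `K` communication rounds. -/
def estimate (G : SimpleGraph V) [DecidableRel G.Adj] (K : ℕ) (η δ : ℝ) (o : V)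
    (xc yc : V → ℕ → ℝ) : ℕ → V → ℝ
  | 0 => fun _ => 0
  | t + 1 => (commRound G)^[K]
      (localUpdate η δ o xc yc (t + 1) (estimate G K η δ o xc yc t))

/-- The group decision value at time `t ≥ 1`: the average over all agents of the estimates at
time `t` before communication. -/
def groupDecision (G : SimpleGraph V) [DecidableRel G.Adj] (K : ℕ) (η δ : ℝ) (o : V)
    (xc yc : V → ℕ → ℝ) (t : ℕ) : ℝ :=
  (∑ i, localUpdate η δ o xc yc t (estimate G K η δ o xc yc (t - 1)) i) / (Fintype.card V : ℝ)

end RobustMean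

end

/-! Let `z t` be `t` times the vector of errors and `b t` the vector of centred trimmed samples.
Averaging is linear and fixes constants, so `z (t + 1) = S (z t + b (t + 1))` with `S = perronMatrix
G ^ K`. Trimming discards at least `8ηt` ranks at each end while at most `2ηt` samples are
corrupted, so the trimming values are eventually caught between true quantiles of level slightly
below `6η`. By Chebyshev-type bounds `‖b t‖` then stays below the radius `s t = σ_X / √(4η + 6
log(4/δ)/t)`, with a margin.

Since `S` does not expand the sup norm, errors grow by at most `s t` per step. For `K ≥ 1`
everything reduces to finding one time `t₀` at which `‖z (t₀ + 1)‖` exceeds the modulus of the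
uniform average of `z t₀ + b (t₀ + 1)` by no more than the other terms can pay; the random time is
then `t₀ + 1` (`bound_of_norm_le`).

Without communication the triangle inequality suffices, and on a complete graph one round produces
the average exactly. Otherwise `λ > 0` (`secondEigenvalue_pos`), so a constant depending on the
graph makes `c λ^K` large for the finitely many `K ≤ K₀`. For those, contraction of oscillations
yields a time at which the disagreement is at most a multiple of the next trimming values, up to a
small slack (`exists_norm_le_of_contraction`).

For `K > K₀` the consensus terms may be negligible and are dropped. The agents nearly agree, and
they follow the mean of `z` under the stationary weights `p`, not the uniform ones. If every `t₀`
failed, this mean would keep one sign, and `∑ (p i - 1/m) b i` would stay large with that sign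
forever (`exists_norm_le_of_mixing`). The law of large numbers forbids this, uniformly in the
adversarial trimming values (`frequently_sum_mul_trim_lt`); `trimming_margin` checks that the
constants fit. -/

noncomputable section

namespace RobustMean

/-! ### Oscillation of vectors and its contraction by stochastic matrices. -/

section Oscillation

variable {V : Type*} [Fintype V]

/-- The oscillation of a finite family of reals. -/
def osc (v : V → ℝ) : ℝ := ‖fun p : V × V => v p.1 - v p.2‖

theorem osc_nonneg (v : V → ℝ) : 0 ≤ osc v := norm_nonneg _

theorem abs_sub_le_osc (v : V → ℝ) (i j : V) : |v i - v j| ≤ osc v :=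
  norm_le_pi_norm (fun p : V × V => v p.1 - v p.2) (i, j)

theorem osc_le {v : V → ℝ} {c : ℝ} (hc : 0 ≤ c) (h : ∀ i j, |v i - v j| ≤ c) : osc v ≤ c :=
  (pi_norm_le_iff_of_nonneg hc).2 fun p => h p.1 p.2

theorem osc_add_le (v w : V → ℝ) : osc (v + w) ≤ osc v + osc w := by
  refine osc_le (add_nonneg (osc_nonneg _) (osc_nonneg _)) fun i j => ?_
  have h : (v + w) i - (v + w) j = (v i - v j) + (w i - w j) := by simp; ring
  rw [h]
  exact (abs_add_le _ _).trans (add_le_add (abs_sub_le_osc v i j) (abs_sub_le_osc w i j))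

/-- Both weighted sums lie between `c * min v` and `c * max v`. -/
theorem abs_sum_sub_sum_le_osc (v A B : V → ℝ) {c : ℝ} (hA : ∀ i, 0 ≤ A i) (hB : ∀ i, 0 ≤ B i)
    (hAc : ∑ i, A i = c) (hBc : ∑ i, B i = c) :
    |∑ i, A i * v i - ∑ i, B i * v i| ≤ c * osc v := by
  rcases isEmpty_or_nonempty V with h | h
  · have : c = 0 := by simpa using hAc.symm
    simp [this]
  obtain ⟨k, hk⟩ := Finite.exists_max v
  obtain ⟨l, hl⟩ := Finite.exists_min v
  have key : ∀ C : V → ℝ, (∀ i, 0 ≤ C i) → ∑ i, C i = c →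
      c * v l ≤ ∑ i, C i * v i ∧ ∑ i, C i * v i ≤ c * v k := by
    intro C hC hCc
    rw [← hCc, Finset.sum_mul, Finset.sum_mul]
    exact ⟨Finset.sum_le_sum fun i _ => mul_le_mul_of_nonneg_left (hl i) (hC i),
      Finset.sum_le_sum fun i _ => mul_le_mul_of_nonneg_left (hk i) (hC i)⟩
  have h1 := key A hA hAc
  have h2 := key B hB hBc
  have hc : 0 ≤ c := hAc ▸ Finset.sum_nonneg fun i _ => hA i
  have h3 : c * (v k - v l) ≤ c * osc v :=
    mul_le_mul_of_nonneg_left ((le_abs_self _).trans (abs_sub_le_osc v k l)) hc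
  rw [abs_le]
  constructor <;> nlinarith

theorem abs_sub_sum_le_osc [DecidableEq V] (v p : V → ℝ) (hp : ∀ i, 0 ≤ p i) (h1 : ∑ i, p i = 1)
    (i : V) :
    |v i - ∑ j, p j * v j| ≤ osc v := by
  have := abs_sum_sub_sum_le_osc v (Pi.single i 1) p (c := 1)
    (fun j => by by_cases h : j = i <;> simp [h]) hp (by simp) h1
  simpa [Pi.single_apply] using this

theorem norm_le_abs_sum_add_osc [DecidableEq V] (v p : V → ℝ) (hp : ∀ i, 0 ≤ p i)
    (h1 : ∑ i, p i = 1) : ‖v‖ ≤ |∑ j, p j * v j| + osc v := by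
  refine (pi_norm_le_iff_of_nonneg (add_nonneg (abs_nonneg _) (osc_nonneg _))).2 fun i => ?_
  have h := abs_sub_sum_le_osc v p hp h1 i
  have := abs_add_le (v i - ∑ j, p j * v j) (∑ j, p j * v j)
  rw [sub_add_cancel] at this
  rw [Real.norm_eq_abs]; linarith

/-- A row stochastic matrix. -/
structure IsStochastic (S : Matrix V V ℝ) : Prop where
  nonneg : ∀ i j, 0 ≤ S i j
  row_sum : ∀ i, ∑ j, S i j = 1

theorem IsStochastic.one [DecidableEq V] : IsStochastic (1 : Matrix V V ℝ) :=
  ⟨fun i j => by rw [Matrix.one_apply]; split_ifs <;> norm_num, fun i => by simp [Matrix.one_apply]⟩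

theorem IsStochastic.mul {S R : Matrix V V ℝ} (hS : IsStochastic S) (hR : IsStochastic R) :
    IsStochastic (S * R) := by
  refine ⟨fun i j => ?_, fun i => ?_⟩
  · rw [Matrix.mul_apply]
    exact Finset.sum_nonneg fun k _ => mul_nonneg (hS.nonneg _ _) (hR.nonneg _ _)
  · simp_rw [Matrix.mul_apply]
    rw [Finset.sum_comm]
    simp_rw [← Finset.mul_sum, hR.row_sum, mul_one, hS.row_sum]

theorem IsStochastic.pow [DecidableEq V] {S : Matrix V V ℝ} (hS : IsStochastic S) (n : ℕ) :
    IsStochastic (S ^ n) := by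
  induction n with
  | zero => simpa using IsStochastic.one
  | succ n ih => rw [pow_succ]; exact ih.mul hS

theorem IsStochastic.norm_mulVec_le {S : Matrix V V ℝ} (hS : IsStochastic S) (v : V → ℝ) :
    ‖S.mulVec v‖ ≤ ‖v‖ := by
  refine (pi_norm_le_iff_of_nonneg (norm_nonneg _)).2 fun i => ?_
  calc ‖S.mulVec v i‖ ≤ ∑ j, ‖S i j * v j‖ := norm_sum_le _ _
    _ ≤ ∑ j, S i j * ‖v‖ := Finset.sum_le_sum fun j _ => by
        rw [norm_mul, Real.norm_of_nonneg (hS.nonneg i j)]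
        exact mul_le_mul_of_nonneg_left (norm_le_pi_norm v j) (hS.nonneg i j)
    _ = ‖v‖ := by rw [← Finset.sum_mul, hS.row_sum, one_mul]

/-- Doeblin's contraction estimate. -/
theorem IsStochastic.osc_mulVec_le [Nonempty V] [DecidableEq V] {S : Matrix V V ℝ}
    (hS : IsStochastic S) {d : ℝ} (hd : ∀ i j, d ≤ S i j) (v : V → ℝ) :
    osc (S.mulVec v) ≤ (1 - d) * osc v := by
  obtain ⟨k⟩ := ‹Nonempty V›
  have hd1 : d ≤ 1 := (hd k k).trans <| by
    rw [← hS.row_sum k]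
    exact Finset.single_le_sum (f := fun j => S k j) (fun j _ => hS.nonneg k j) (Finset.mem_univ k)
  refine osc_le (mul_nonneg (by linarith) (osc_nonneg v)) fun i j => ?_
  -- Removing mass `d` at the same column `k` from every row does not change differences between
  -- rows; what is left has mass `1 - d`.
  have hn : ∀ i l, 0 ≤ S i l - Pi.single (M := fun _ => ℝ) k d l := fun i l => by
    by_cases h : l = k
    · subst h; simpa using hd i l
    · simpa [Pi.single_apply, h] using hS.nonneg i l
  have hs : ∀ i, ∑ l, (S i l - Pi.single (M := fun _ => ℝ) k d l) = 1 - d := fun i => by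
    rw [Finset.sum_sub_distrib, hS.row_sum]; simp
  have := abs_sum_sub_sum_le_osc v _ _ (hn i) (hn j) (hs i) (hs j)
  simpa [Matrix.mulVec, dotProduct, sub_mul, Finset.sum_sub_distrib] using this

theorem IsStochastic.osc_mulVec_le_osc [Nonempty V] [DecidableEq V] {S : Matrix V V ℝ}
    (hS : IsStochastic S) (v : V → ℝ) : osc (S.mulVec v) ≤ osc v := by
  simpa using hS.osc_mulVec_le hS.nonneg v

/-- The accumulated oscillation along the first `N` powers of `S`: it is contracted by `S` as soon
as `S ^ N` is positive. -/
def accOsc [DecidableEq V] (S : Matrix V V ℝ) (N : ℕ) (v : V → ℝ) : ℝ :=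
  ∑ k ∈ Finset.range N, osc ((S ^ k).mulVec v)

variable [DecidableEq V]

theorem accOsc_nonneg (S : Matrix V V ℝ) (N : ℕ) (v : V → ℝ) : 0 ≤ accOsc S N v :=
  Finset.sum_nonneg fun _ _ => osc_nonneg _

theorem accOsc_add_le (S : Matrix V V ℝ) (N : ℕ) (v w : V → ℝ) :
    accOsc S N (v + w) ≤ accOsc S N v + accOsc S N w := by
  rw [accOsc, accOsc, accOsc, ← Finset.sum_add_distrib]
  refine Finset.sum_le_sum fun k _ => ?_
  rw [Matrix.mulVec_add]
  exact osc_add_le _ _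

theorem osc_le_accOsc (S : Matrix V V ℝ) {N : ℕ} (hN : 0 < N) (v : V → ℝ) :
    osc v ≤ accOsc S N v := by
  have := Finset.single_le_sum (f := fun k => osc ((S ^ k).mulVec v))
    (fun k _ => osc_nonneg _) (Finset.mem_range.2 hN)
  simp only [pow_zero, Matrix.one_mulVec] at this
  exact this

theorem accOsc_le [Nonempty V] {S : Matrix V V ℝ} (hS : IsStochastic S) (N : ℕ) (v : V → ℝ) :
    accOsc S N v ≤ N * osc v := by
  calc accOsc S N v ≤ ∑ k ∈ Finset.range N, osc v :=
        Finset.sum_le_sum fun k _ => (hS.pow k).osc_mulVec_le_osc v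
    _ = N * osc v := by simp

/-- Applying `S` shifts the sum: the term `osc v` is replaced by `osc (S ^ N v)`, a loss of at least
`d * osc v`, and `osc v` is at least a fraction `1 / N` of the sum. So a contraction available only
after `N` steps becomes a one-step contraction. -/
theorem accOsc_mulVec_le [Nonempty V] {S : Matrix V V ℝ} (hS : IsStochastic S) {N : ℕ}
    (hN : 0 < N) {d : ℝ} (hd0 : 0 ≤ d) (hd : ∀ i j, d ≤ (S ^ N) i j) (v : V → ℝ) :
    accOsc S N (S.mulVec v) ≤ (1 - d / N) * accOsc S N v := by
  have h1 : accOsc S N (S.mulVec v) + osc v = accOsc S N v + osc ((S ^ N).mulVec v) := by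
    have h := Finset.sum_range_succ (fun k => osc ((S ^ k).mulVec v)) N
    rw [Finset.sum_range_succ'] at h
    simp only [pow_zero, Matrix.one_mulVec, pow_succ, ← Matrix.mulVec_mulVec] at h
    rw [accOsc, accOsc]
    exact h
  have h2 := (hS.pow N).osc_mulVec_le hd v
  have h3 := accOsc_le hS N v
  have hN' : (0 : ℝ) < N := by exact_mod_cast hN
  have h4 : d / N * accOsc S N v ≤ d * osc v := by
    calc d / N * accOsc S N v ≤ d / N * (N * osc v) :=
          mul_le_mul_of_nonneg_left h3 (by positivity)
      _ = d * osc v := by field_simp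
  linarith

theorem accOsc_pow_mulVec_le [Nonempty V] {S : Matrix V V ℝ} {N : ℕ} {r : ℝ} (hr : 0 ≤ r)
    (h : ∀ v, accOsc S N (S.mulVec v) ≤ r * accOsc S N v) (K : ℕ) (v : V → ℝ) :
    accOsc S N ((S ^ K).mulVec v) ≤ r ^ K * accOsc S N v := by
  induction K with
  | zero => simp
  | succ K ih =>
    rw [pow_succ' S, ← Matrix.mulVec_mulVec, pow_succ', mul_assoc]
    exact (h _).trans (mul_le_mul_of_nonneg_left ih hr)

end Oscillation

/-! ### The Perron matrix: positivity of powers, stationary weights, complete graphs. -/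

section Graph

variable {V : Type*} [Fintype V] [DecidableEq V] (G : SimpleGraph V) [DecidableRel G.Adj]

theorem perronMatrix_apply (i j : V) :
    perronMatrix G i j = (1 + (G.degree i : ℝ))⁻¹ * (1 + G.adjMatrix ℝ) i j := by
  have hD : (1 + G.degMatrix ℝ) = Matrix.diagonal fun i => 1 + (G.degree i : ℝ) := by
    rw [SimpleGraph.degMatrix, ← Matrix.diagonal_one, Matrix.diagonal_add]
  have hinv : (1 + G.degMatrix ℝ)⁻¹ = Matrix.diagonal fun i => (1 + (G.degree i : ℝ))⁻¹ := by
    refine Matrix.inv_eq_left_inv ?_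
    rw [hD, Matrix.diagonal_mul_diagonal, ← Matrix.diagonal_one]
    congr 1; ext i
    exact inv_mul_cancel₀ (by positivity)
  rw [perronMatrix, hinv, Matrix.diagonal_mul]

theorem one_add_adjMatrix_mulVec (v : V → ℝ) (i : V) :
    (1 + G.adjMatrix ℝ).mulVec v i = ∑ j ∈ insert i (G.neighborFinset i), v j := by
  rw [Matrix.add_mulVec, Pi.add_apply, Matrix.one_mulVec, SimpleGraph.adjMatrix_mulVec_apply,
    Finset.sum_insert (by simp)]

theorem commRound_eq_mulVec (v : V → ℝ) : commRound G v = (perronMatrix G).mulVec v := by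
  ext i
  have h : (perronMatrix G).mulVec v i
      = (1 + (G.degree i : ℝ))⁻¹ * (1 + G.adjMatrix ℝ).mulVec v i := by
    simp only [Matrix.mulVec, dotProduct, perronMatrix_apply, Finset.mul_sum, mul_assoc]
  rw [h, one_add_adjMatrix_mulVec, commRound, Finset.card_insert_of_notMem (by simp),
    G.card_neighborFinset_eq_degree, div_eq_inv_mul]
  push_cast; rw [add_comm]

theorem commRound_iterate (K : ℕ) (v : V → ℝ) :
    (commRound G)^[K] v = (perronMatrix G ^ K).mulVec v := by
  induction K with
  | zero => simp
  | succ K ih =>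
    rw [Function.iterate_succ_apply', ih, commRound_eq_mulVec, Matrix.mulVec_mulVec, pow_succ']

theorem isStochastic_perronMatrix : IsStochastic (perronMatrix G) := by
  refine ⟨fun i j => ?_, fun i => ?_⟩
  · rw [perronMatrix_apply]
    refine mul_nonneg (by positivity) ?_
    rw [Matrix.add_apply, Matrix.one_apply, SimpleGraph.adjMatrix_apply]
    split_ifs <;> norm_num
  · have h := congrFun (commRound_eq_mulVec G fun _ => 1) i
    have h0 : ((G.degree i : ℝ) + 1) ≠ 0 := by positivity
    simpa [commRound, h0, Matrix.mulVec, dotProduct] using h.symm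

theorem perronMatrix_self_pos (i : V) : 0 < perronMatrix G i i := by
  rw [perronMatrix_apply]
  have : (1 + G.adjMatrix ℝ) i i = 1 := by simp
  rw [this]; positivity

theorem perronMatrix_adj_pos {i j : V} (h : G.Adj i j) : 0 < perronMatrix G i j := by
  rw [perronMatrix_apply]
  have : (1 + G.adjMatrix ℝ) i j = 1 := by simp [h, h.ne]
  rw [this]; positivity

/-- Diagonal entries are positive, so a short walk can be padded by waiting at a vertex. -/
theorem perronMatrix_pow_pos {i j : V} (p : G.Walk i j) (n : ℕ) (h : p.length ≤ n) :
    0 < (perronMatrix G ^ n) i j := by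
  have hS := isStochastic_perronMatrix G
  have key : ∀ (n : ℕ) (i k j : V), 0 < perronMatrix G i k → 0 < (perronMatrix G ^ n) k j →
      0 < (perronMatrix G ^ (n + 1)) i j := by
    intro n i k j h1 h2
    rw [pow_succ', Matrix.mul_apply]
    exact Finset.sum_pos' (fun l _ => mul_nonneg (hS.nonneg _ _) ((hS.pow n).nonneg _ _))
      ⟨k, Finset.mem_univ k, mul_pos h1 h2⟩
  induction n generalizing i j with
  | zero =>
    have := SimpleGraph.Walk.eq_of_length_eq_zero (Nat.le_zero.1 h)
    subst this; simp
  | succ n ih =>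
    cases p with
    | nil => exact key n i i i (perronMatrix_self_pos G i) (ih SimpleGraph.Walk.nil (by simp))
    | cons hadj q =>
      exact key n i _ j (perronMatrix_adj_pos G hadj) (ih q (by simpa using h))

variable {G}

theorem exists_accOsc_contraction (hG : G.Connected) : ∃ (N : ℕ) (r : ℝ), 0 < N ∧ 0 < r ∧ r < 1 ∧
    ∀ v, accOsc (perronMatrix G) N ((perronMatrix G).mulVec v)
      ≤ r * accOsc (perronMatrix G) N v := by
  have := hG.nonempty
  have hN : 0 < Fintype.card V := Fintype.card_pos
  have hpos : ∀ i j, 0 < (perronMatrix G ^ Fintype.card V) i j := fun i j => by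
    obtain ⟨p, hp⟩ := hG.exists_isPath i j
    exact perronMatrix_pow_pos G p _ hp.length_lt.le
  obtain ⟨p, hp⟩ := Finite.exists_min
    (fun p : V × V => (perronMatrix G ^ Fintype.card V) p.1 p.2)
  set d := (perronMatrix G ^ Fintype.card V) p.1 p.2 with hd
  have hd0 : 0 < d := hpos _ _
  have hd1 : d ≤ 1 := by
    have hS := (isStochastic_perronMatrix G).pow (Fintype.card V)
    rw [← hS.row_sum p.1]
    exact Finset.single_le_sum (f := fun j => (perronMatrix G ^ Fintype.card V) p.1 j)
      (fun j _ => hS.nonneg p.1 j) (Finset.mem_univ p.2)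
  have hN' : (1 : ℝ) ≤ Fintype.card V := by exact_mod_cast hN
  -- Halving `d` keeps the factor positive even for a single vertex, where `d = 1` and the exponent
  -- is `1`.
  refine ⟨Fintype.card V, 1 - d / 2 / Fintype.card V, hN, ?_, ?_, fun v =>
    accOsc_mulVec_le (isStochastic_perronMatrix G) hN (by positivity)
      (fun i j => (half_le_self hd0.le).trans (hp (i, j))) v⟩
  · rw [sub_pos, div_lt_one (by positivity)]; linarith
  · rw [sub_lt_self_iff]; positivity

/-- The stationary distribution of the Perron matrix. -/
def stationary (G : SimpleGraph V) [DecidableRel G.Adj] (i : V) : ℝ :=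
  (1 + (G.degree i : ℝ)) / ∑ j, (1 + (G.degree j : ℝ))

theorem stationary_nonneg (i : V) : 0 ≤ stationary G i := by
  unfold stationary; positivity

theorem sum_one_add_degree_pos [Nonempty V] : 0 < ∑ j : V, (1 + (G.degree j : ℝ)) :=
  Finset.sum_pos (fun _ _ => by positivity) Finset.univ_nonempty

theorem sum_stationary [Nonempty V] : ∑ i, stationary G i = 1 := by
  simp only [stationary]
  rw [← Finset.sum_div, div_self (sum_one_add_degree_pos (G := G)).ne']

/-- Detailed balance: weighting row `i` by `1 + deg i` leaves the symmetric matrix `I + A`. -/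
theorem sum_stationary_mulVec (v : V → ℝ) :
    ∑ i, stationary G i * (perronMatrix G).mulVec v i = ∑ i, stationary G i * v i := by
  simp only [Matrix.mulVec, dotProduct, Finset.mul_sum]
  rw [Finset.sum_comm]
  refine Finset.sum_congr rfl fun j _ => ?_
  have h : ∀ i, stationary G i * (perronMatrix G i j * v j)
      = (∑ j, (1 + (G.degree j : ℝ)))⁻¹ * v j * (1 + G.adjMatrix ℝ) j i := fun i => by
    have hsym : (1 + G.adjMatrix ℝ) i j = (1 + G.adjMatrix ℝ) j i := by
      simp [Matrix.one_apply, SimpleGraph.adjMatrix_apply, G.adj_comm, eq_comm]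
    rw [perronMatrix_apply, stationary, hsym]
    have : (1 + (G.degree i : ℝ)) ≠ 0 := by positivity
    field_simp
  simp_rw [h]
  rw [← Finset.mul_sum]
  have := one_add_adjMatrix_mulVec G (fun _ => 1) j
  simp only [Matrix.mulVec, dotProduct, mul_one, Finset.sum_const] at this
  rw [this, Finset.card_insert_of_notMem (by simp), G.card_neighborFinset_eq_degree, stationary]
  simp; ring

theorem sum_stationary_pow_mulVec (K : ℕ) (v : V → ℝ) :
    ∑ i, stationary G i * (perronMatrix G ^ K).mulVec v i = ∑ i, stationary G i * v i := by
  induction K with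
  | zero => simp
  | succ K ih => rw [pow_succ', ← Matrix.mulVec_mulVec, sum_stationary_mulVec, ih]

/-- The difference between the stationary and the uniform distribution. -/
def bias (G : SimpleGraph V) [DecidableRel G.Adj] (i : V) : ℝ :=
  stationary G i - 1 / (Fintype.card V : ℝ)

theorem sum_bias [Nonempty V] : ∑ i, bias G i = 0 := by
  simp [bias, Finset.sum_sub_distrib, sum_stationary]

/-- A connected graph has at least `m - 1` edges, so `S = ∑ (1 + deg) ≥ 3m - 2`, and every
stationary weight lies in `[2/S, m/S]`. The second bound records that the `ℓ¹` and `ℓ²` norms of the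
bias cannot both be extreme; `trimming_margin` relies on this trade-off. -/
theorem bias_bounds (hG : G.Connected) (hV : 2 ≤ Fintype.card V) :
    ∑ i, bias G i ^ 2 ≤ 1 / 3 ∧ ∑ i, |bias G i| ≤ 2 * (1 - 2 * ∑ i, bias G i ^ 2) := by
  have := hG.nonempty
  have : Nontrivial V := Fintype.one_lt_card_iff_nontrivial.1 hV
  set m : ℝ := (Fintype.card V : ℝ) with hm
  set S : ℝ := ∑ j : V, (1 + (G.degree j : ℝ)) with hS
  have hm2 : (2 : ℝ) ≤ m := by rw [hm]; exact_mod_cast hV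
  have hSm : 3 * m - 2 ≤ S := by
    have h1 := hG.card_vert_le_card_edgeSet_add_one
    rw [Nat.card_eq_fintype_card, Nat.card_eq_fintype_card, ← SimpleGraph.edgeFinset_card] at h1
    have h2 := G.sum_degrees_eq_twice_card_edges
    have h3 : S = m + 2 * (G.edgeFinset.card : ℝ) := by
      rw [hS, Finset.sum_add_distrib]
      simp only [Finset.sum_const, Finset.card_univ, nsmul_eq_mul, mul_one]
      rw [← hm]; congr 1; exact_mod_cast h2
    have h4 : m ≤ (G.edgeFinset.card : ℝ) + 1 := by rw [hm]; exact_mod_cast h1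
    linarith
  have hS0 : 0 < S := by linarith
  have hpi1 : ∀ i, stationary G i ≤ m / S := fun i => by
    have := G.degree_lt_card_verts i
    have h' : 1 + (G.degree i : ℝ) ≤ m := by rw [hm]; exact_mod_cast (by omega)
    exact div_le_div_of_nonneg_right h' hS0.le
  have hpi2 : ∀ i, 2 / S ≤ stationary G i := fun i => by
    have : 0 < G.degree i := hG.preconnected.degree_pos_of_nontrivial i
    have h' : (2 : ℝ) ≤ 1 + (G.degree i : ℝ) := by exact_mod_cast (by omega)
    exact div_le_div_of_nonneg_right h' hS0.le
  have hsum := sum_stationary (G := G)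
  have hsq : ∑ i, bias G i ^ 2 ≤ m / S - 1 / m := by
    have h1 : ∑ i, bias G i ^ 2 = ∑ i, stationary G i ^ 2 - 1 / m := by
      have : ∀ i, bias G i ^ 2 = stationary G i ^ 2 - 2 / m * stationary G i + 1 / m ^ 2 :=
        fun i => by rw [bias]; ring
      simp_rw [this, Finset.sum_add_distrib, Finset.sum_sub_distrib]
      rw [← Finset.mul_sum, hsum]
      simp only [Finset.sum_const, Finset.card_univ, nsmul_eq_mul]
      rw [← hm]; field_simp; ring
    have h2 : ∑ i, stationary G i ^ 2 ≤ m / S := by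
      calc ∑ i, stationary G i ^ 2 ≤ ∑ i, m / S * stationary G i :=
            Finset.sum_le_sum fun i _ => by
              rw [sq]; exact mul_le_mul_of_nonneg_right (hpi1 i) (stationary_nonneg i)
        _ = m / S := by rw [← Finset.mul_sum, hsum, mul_one]
    linarith
  have hms : m / S ≤ m / (3 * m - 2) :=
    div_le_div_of_nonneg_left (by linarith) (by linarith) hSm
  refine ⟨hsq.trans ?_, ?_⟩
  · have : m / (3 * m - 2) - 1 / m ≤ 1 / 3 := by
      rw [div_sub_div _ _ (by linarith) (by linarith), div_le_div_iff₀ (by nlinarith) (by norm_num)]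
      nlinarith
    linarith
  -- A number `x ≥ -c` with `c ≥ 0` satisfies `|x| ≤ x + 2c`; on summation the linear part vanishes.
  · have h1 : ∀ i, |bias G i| ≤ bias G i + 2 * (1 / m - 2 / S) := fun i => by
      have hb : bias G i = stationary G i - 1 / m := rfl
      have h2S : 2 / S ≤ 1 / m := by
        rw [div_le_div_iff₀ hS0 (by linarith)]; linarith
      rw [abs_le]
      constructor <;> linarith [hpi2 i]
    have h2 : ∑ i, |bias G i| ≤ 2 * (1 - 2 * (m / S)) := by
      calc ∑ i, |bias G i| ≤ ∑ i, (bias G i + 2 * (1 / m - 2 / S)) :=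
            Finset.sum_le_sum fun i _ => h1 i
        _ = 2 * (1 - 2 * (m / S)) := by
            rw [Finset.sum_add_distrib, sum_bias]
            simp only [Finset.sum_const, Finset.card_univ, nsmul_eq_mul]
            rw [← hm]; field_simp; ring
    have h3 : 0 ≤ 1 / m := by positivity
    linarith

theorem eq_of_perronMatrix_mulVec_eq (hG : G.Connected) {v : V → ℝ}
    (h : (perronMatrix G).mulVec v = v) (i j : V) : v i = v j := by
  have := hG.nonempty
  obtain ⟨N, r, hN, hr0, hr1, hr⟩ := exists_accOsc_contraction hG
  have h1 := hr v
  rw [h] at h1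
  have h2 := accOsc_nonneg (perronMatrix G) N v
  have h3 := osc_le_accOsc (perronMatrix G) hN v
  have h4 := abs_sub_le_osc v i j
  have h5 : accOsc (perronMatrix G) N v ≤ 0 := by nlinarith
  have h6 : |v i - v j| = 0 := le_antisymm (by linarith) (abs_nonneg _)
  exact sub_eq_zero.1 (abs_eq_zero.1 h6)

theorem commRound_of_complete (h : ∀ i j, i ≠ j → G.Adj i j) (v : V → ℝ) (i : V) :
    (perronMatrix G).mulVec v i = (∑ j, v j) / Fintype.card V := by
  rw [← commRound_eq_mulVec, commRound]
  have : insert i (G.neighborFinset i) = Finset.univ := by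
    ext j; by_cases hj : j = i
    · simp [hj]
    · simpa [hj] using h i j (Ne.symm hj)
  rw [this, Finset.card_univ]

/-- The matrix averages uniformly, so a nonzero eigenvalue has a constant eigenvector and equals
`1`. With one vertex the set is empty and its supremum is `0`. -/
theorem secondEigenvalue_nonneg_of_complete (hG : G.Connected) (h : ∀ i j, i ≠ j → G.Adj i j) :
    0 ≤ secondEigenvalue G := by
  have := hG.nonempty
  refine Real.sSup_nonneg fun θ hθ => ?_
  obtain ⟨hθ, hθ1⟩ := hθ
  obtain ⟨v, hv⟩ := hθ.exists_hasEigenvector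
  have h1 : ∀ i, θ * v i = (∑ j, v j) / Fintype.card V := fun i => by
    rw [← commRound_of_complete h v i, ← Matrix.toLin'_apply, hv.apply_eq_smul]; simp
  by_contra hneg
  have hθ0 : θ ≠ 0 := by rintro rfl; exact hneg le_rfl
  refine hθ1 ?_
  obtain ⟨i, hi⟩ := Function.ne_iff.1 hv.2
  have hconst : ∀ j, v j = v i := fun j =>
    mul_left_cancel₀ hθ0 ((h1 j).trans (h1 i).symm)
  have h2 := h1 i
  simp_rw [hconst] at h2
  have hc : (Fintype.card V : ℝ) ≠ 0 := by exact_mod_cast Fintype.card_ne_zero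
  rw [Finset.sum_const, Finset.card_univ, nsmul_eq_mul, mul_div_cancel_left₀ _ hc] at h2
  exact mul_right_cancel₀ (by simpa using hi) (h2.trans (one_mul _).symm)

end Graph

/-! ### Positivity of the second eigenvalue for non-complete graphs. -/

section Spectrum
variable {V : Type*} [Fintype V] [DecidableEq V] (G : SimpleGraph V) [DecidableRel G.Adj]

/-- The symmetrization `(I + D)^(-1/2) (I + A) (I + D)^(-1/2)` of the Perron matrix. -/
def symmPerron : Matrix V V ℝ :=
  Matrix.of fun i j => (1 + G.adjMatrix ℝ) i j / (√(1 + G.degree i) * √(1 + G.degree j))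

theorem sqrt_one_add_degree_pos (i : V) : 0 < √(1 + (G.degree i : ℝ)) :=
  Real.sqrt_pos.2 (by positivity)

theorem symmPerron_isHermitian : (symmPerron G).IsHermitian := by
  ext i j
  simp [symmPerron, Matrix.one_apply, SimpleGraph.adjMatrix_apply, G.adj_comm, eq_comm, mul_comm]

theorem perronMatrix_mulVec_of_symmPerron {u : V → ℝ} {θ : ℝ}
    (h : (symmPerron G).mulVec u = θ • u) :
    (perronMatrix G).mulVec (fun i => u i / √(1 + G.degree i))
      = θ • fun i => u i / √(1 + (G.degree i : ℝ)) := by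
  ext i
  have h1 := congrFun h i
  have hp := sqrt_one_add_degree_pos G i
  have hsq : √(1 + (G.degree i : ℝ)) * √(1 + (G.degree i : ℝ)) = 1 + G.degree i :=
    Real.mul_self_sqrt (by positivity)
  simp only [Pi.smul_apply, smul_eq_mul, Matrix.mulVec, dotProduct] at h1 ⊢
  rw [← mul_div_assoc, ← h1, Finset.sum_div]
  refine Finset.sum_congr rfl fun j _ => ?_
  have hq := sqrt_one_add_degree_pos G j
  rw [perronMatrix_apply, symmPerron, Matrix.of_apply,
    show (1 + (G.degree i : ℝ))⁻¹ = (√(1 + (G.degree i : ℝ)) * √(1 + (G.degree i : ℝ)))⁻¹ by rw [hsq]]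
  field_simp

variable {G}

/-- On the coordinates `p, q` the symmetrized matrix is diagonal and positive, so its form is
positive on some vector orthogonal to the eigenvectors for `1`. Were all other eigenvalues
nonpositive, the form would be nonpositive there. -/
theorem secondEigenvalue_pos (hG : G.Connected) {p q : V} (hpq : p ≠ q) (hadj : ¬ G.Adj p q) :
    0 < secondEigenvalue G := by
  have hT := Matrix.isSymmetric_toEuclideanLin_iff.2 (symmPerron_isHermitian G)
  set T := Matrix.toEuclideanLin (symmPerron G) with hTdef
  set b := hT.eigenvectorBasis (n := Fintype.card V) (by simp) with hb
  set μ := hT.eigenvalues (n := Fintype.card V) (by simp) with hμ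
  have hTb : ∀ k, T (b k) = μ k • b k := fun k => hT.apply_eigenvectorBasis (by simp) k
  have hPb : ∀ k, (perronMatrix G).mulVec (fun i => b k i / √(1 + G.degree i))
      = μ k • fun i => b k i / √(1 + (G.degree i : ℝ)) := fun k =>
    perronMatrix_mulVec_of_symmPerron G (by
      have := congrArg WithLp.ofLp (hTb k)
      simpa [hTdef] using this)
  have hbdd : BddAbove {θ : ℝ | Module.End.HasEigenvalue (Matrix.toLin' (perronMatrix G)) θ
      ∧ θ ≠ 1} :=
    ((Module.End.finite_hasEigenvalue (Matrix.toLin' (perronMatrix G))).subset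
      fun _ h => h.1).bddAbove
  have hne : ∀ k, ∃ i, b k i ≠ 0 := fun k => by
    by_contra! h
    refine b.orthonormal.ne_zero k ?_
    ext i; simpa using h i
  suffices h : ∃ k, 0 < μ k ∧ μ k ≠ 1 by
    obtain ⟨k, hk, hk1⟩ := h
    refine hk.trans_le (le_csSup hbdd ⟨?_, hk1⟩)
    refine Module.End.hasEigenvalue_of_hasEigenvector
      (x := fun i => b k i / √(1 + (G.degree i : ℝ))) ⟨?_, ?_⟩
    · rw [Module.End.mem_eigenspace_iff, Matrix.toLin'_apply, hPb k]
    · obtain ⟨i, hi⟩ := hne k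
      exact fun h0 => div_ne_zero hi (sqrt_one_add_degree_pos G i).ne' (congrFun h0 i)
  by_contra! hcon
  set r : V → ℝ := fun i => √(1 + (G.degree i : ℝ)) with hr
  have hrp : ∀ i, 0 < r i := sqrt_one_add_degree_pos G
  -- Eigenvectors for `1` are multiples of `r`; this is the combination of the two basis vectors
  -- orthogonal to `r`.
  set w : EuclideanSpace ℝ V := EuclideanSpace.single p (r q) - EuclideanSpace.single q (r p)
    with hw
  have hwi : ∀ f : V → ℝ, ∑ i, f i * w i = f p * r q - f q * r p := fun f => by
    simp [hw, mul_sub, Finset.sum_sub_distrib]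
  have hinner : ∀ v : EuclideanSpace ℝ V, inner ℝ v w = v p * r q - v q * r p := fun v => by
    rw [← hwi, PiLp.inner_apply]
    exact Finset.sum_congr rfl fun i _ => by simp [mul_comm]
  have hform : inner ℝ (T w) w = 1 / r p * r q ^ 2 / r p + 1 / r q * r p ^ 2 / r q := by
    rw [hinner]
    have hTw : ∀ i, T w i = symmPerron G i p * r q - symmPerron G i q * r p := fun i => by
      rw [← hwi]; rfl
    rw [hTw, hTw]
    have h1 : symmPerron G p p = 1 / (r p * r p) := by simp [symmPerron, hr]
    have h2 : symmPerron G q q = 1 / (r q * r q) := by simp [symmPerron, hr]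
    have h3 : symmPerron G p q = 0 := by simp [symmPerron, hpq, hadj]
    have h4 : symmPerron G q p = 0 := by
      simp [symmPerron, hpq.symm, mt (G.adj_symm (u := q) (v := p)) hadj]
    rw [h1, h2, h3, h4]
    have := hrp p
    have := hrp q
    field_simp; ring
  have hpos : 0 < inner ℝ (T w) w := by
    rw [hform]
    have := hrp p
    have := hrp q
    positivity
  refine absurd hpos (not_lt.2 ?_)
  rw [← b.sum_inner_mul_inner (T w) w]
  refine Finset.sum_nonpos fun k _ => ?_
  have h1 : inner ℝ (T w) (b k) = μ k * inner ℝ (b k) w := by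
    rw [hT w (b k), hTb k, inner_smul_right, real_inner_comm]
  rw [h1]
  rcases le_or_gt (μ k) 0 with h | h
  · nlinarith [mul_self_nonneg (inner ℝ (b k) w)]
  · have hconst := eq_of_perronMatrix_mulVec_eq hG
      (v := fun i => b k i / √(1 + (G.degree i : ℝ))) (by rw [hPb k, hcon k h, one_smul]) p q
    have : inner ℝ (b k) w = 0 := by
      rw [hinner, sub_eq_zero]
      exact (div_eq_div_iff (hrp p).ne' (hrp q).ne').1 hconst
    rw [this]; simp

end Spectrum

/-! ### Order statistics, trimming, and resistance to corruption. -/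

section OrderStatistics

theorem card_filter_sortedSample (y : ℕ → ℝ) (t : ℕ) (p : ℝ → Prop) [DecidablePred p] :
    (Finset.univ.filter fun i : Fin t => p (sortedSample y t i)).card
      = ((Finset.Icc 1 t).filter fun j => p (y j)).card := by
  have h1 : (Finset.univ.filter fun i : Fin t => p (sortedSample y t i)).card
      = (Finset.univ.filter fun i : Fin t => p (y (i + 1))).card :=
    Finset.card_equiv (Tuple.sort fun j : Fin t => y (j + 1)) fun i => by
      simp only [Finset.mem_filter, Finset.mem_univ, true_and]; rfl
  rw [h1]
  refine Finset.card_bij (fun i _ => (i : ℕ) + 1) ?_ ?_ ?_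
  · intro i hi
    simp only [Finset.mem_filter, Finset.mem_univ, true_and, Finset.mem_Icc] at hi ⊢
    exact ⟨by omega, hi⟩
  · intro i _ j _ h
    exact Fin.ext (by omega)
  · intro j hj
    simp only [Finset.mem_filter, Finset.mem_Icc] at hj
    refine ⟨⟨j - 1, by omega⟩, ?_, by simp; omega⟩
    have : j - 1 + 1 = j := by omega
    simpa [this] using hj.2

theorem monotone_sortedSample (y : ℕ → ℝ) (t : ℕ) : Monotone (sortedSample y t) :=
  Tuple.monotone_sort _

theorem orderStat_mono (y : ℕ → ℝ) (t : ℕ) {r r' : ℝ} (h : r ≤ r') :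
    orderStat y t r ≤ orderStat y t r' := by
  unfold orderStat
  split_ifs
  · refine monotone_sortedSample y t ?_
    rw [Fin.mk_le_mk]
    have := Nat.ceil_mono h
    omega
  · exact le_rfl

theorem le_card_of_orderStat_lt {y : ℕ → ℝ} {t : ℕ} (ht : 0 < t) {r a : ℝ} (hr : r ≤ t)
    (h : orderStat y t r < a) : r ≤ ((Finset.Icc 1 t).filter fun j => y j < a).card := by
  rw [orderStat, dif_pos ht] at h
  rw [← card_filter_sortedSample y t (· < a)]
  have h1 := (Tuple.lt_card_lt_iff_apply_lt_of_monotone (monotone_sortedSample y t)).2 h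
  have h2 : ⌈r⌉₊ ≤ t := Nat.ceil_le.2 hr
  refine (Nat.le_ceil r).trans ?_
  simp only at h1
  exact_mod_cast (by omega)

theorem le_card_of_lt_orderStat {y : ℕ → ℝ} {t : ℕ} (ht : 0 < t) {r b : ℝ} (hr : 0 ≤ r)
    (h : b < orderStat y t r) :
    t - r ≤ ((Finset.Icc 1 t).filter fun j => b < y j).card := by
  rw [orderStat, dif_pos ht] at h
  rw [← card_filter_sortedSample y t (b < ·)]
  have h1 := mt (Tuple.lt_card_le_iff_apply_le_of_monotone (monotone_sortedSample y t)).1 h.not_ge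
  have h2 := Finset.card_filter_add_card_filter_not (s := (Finset.univ : Finset (Fin t)))
    (fun i => sortedSample y t i ≤ b)
  simp only [not_le, Finset.card_univ, Fintype.card_fin] at h2
  simp only [not_lt] at h1
  have h3 : ((⌈r⌉₊ - 1 : ℕ) : ℝ) ≤ r := by
    rcases Nat.eq_zero_or_pos ⌈r⌉₊ with h0 | h0
    · simp [h0, hr]
    · rw [Nat.cast_sub h0]
      have := Nat.ceil_lt_add_one hr
      push_cast; linarith
  have h4 : t ≤ (⌈r⌉₊ - 1)
      + (Finset.univ.filter fun i : Fin t => b < sortedSample y t i).card := by omega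
  have h5 : (t : ℝ) ≤ ((⌈r⌉₊ - 1 : ℕ) : ℝ)
      + ((Finset.univ.filter fun i : Fin t => b < sortedSample y t i).card : ℝ) := by
    exact_mod_cast h4
  linarith

theorem card_filter_le_add_card_ne (y yc : ℕ → ℝ) (t : ℕ) (p : ℝ → Prop) [DecidablePred p] :
    (((Finset.Icc 1 t).filter fun j => p (yc j)).card : ℝ)
      ≤ ((Finset.Icc 1 t).filter fun j => p (y j)).card
        + ((Finset.Icc 1 t).filter fun j => yc j ≠ y j).card := by
  have : ((Finset.Icc 1 t).filter fun j => p (yc j)) ⊆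
      ((Finset.Icc 1 t).filter fun j => p (y j)) ∪ ((Finset.Icc 1 t).filter fun j => yc j ≠ y j) := by
    intro j
    simp only [Finset.mem_filter, Finset.mem_union]
    rintro ⟨h1, h2⟩
    by_cases h : yc j = y j
    · exact Or.inl ⟨h1, h ▸ h2⟩
    · exact Or.inr ⟨h1, h⟩
  exact_mod_cast (Finset.card_le_card this).trans (Finset.card_union_le _ _)

theorem trim_mem_Icc {α β : ℝ} (h : α ≤ β) (x : ℝ) : trim α β x ∈ Set.Icc α β := by
  unfold trim
  split_ifs with h1 h2
  · exact ⟨h, le_rfl⟩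
  · exact ⟨le_rfl, h⟩
  · exact ⟨not_lt.1 h2, not_lt.1 h1⟩

/-- Layer-cake form: the trimming values enter only through the limits of integration and an
additive constant, which lets them be adversarial. -/
theorem trim_eq_add_integral {α β : ℝ} (h : α ≤ β) (x : ℝ) :
    trim α β x = α + ∫ u in α..β, (if u < x then (1 : ℝ) else 0) := by
  have key : ∀ c d : ℝ, c ≤ d → d ≤ x → ∫ u in c..d, (if u < x then (1 : ℝ) else 0) = d - c := by
    intro c d hcd hd
    rw [intervalIntegral.integral_of_le hcd, integral_Ioc_eq_integral_Ioo,
      setIntegral_congr_fun (g := fun _ => (1 : ℝ)) measurableSet_Ioo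
        fun u hu => by simp [hu.2.trans_le hd]]
    simp [hcd]
  have key2 : ∀ c d : ℝ, c ≤ d → x ≤ c → ∫ u in c..d, (if u < x then (1 : ℝ) else 0) = 0 := by
    intro c d hcd hd
    rw [intervalIntegral.integral_of_le hcd,
      setIntegral_congr_fun (g := fun _ => (0 : ℝ)) measurableSet_Ioc
        fun u hu => by simp [(hd.trans hu.1.le).not_gt]]
    simp
  have hint : ∀ c d : ℝ, IntervalIntegrable (fun u => if u < x then (1 : ℝ) else 0) volume c d :=
    fun c d => by
      have : AntitoneOn (fun u => if u < x then (1 : ℝ) else 0) (Set.uIcc c d) := by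
        intro u _ v _ huv
        dsimp only
        split_ifs with h1 h2
        · exact le_rfl
        · exact absurd (huv.trans_lt h1) h2
        · exact zero_le_one
        · exact le_rfl
      exact this.intervalIntegrable
  unfold trim
  split_ifs with h1 h2
  · rw [key α β h h1.le]; ring
  · rw [key2 α β h h2.le]; ring
  · rw [← intervalIntegral.integral_add_adjacent_intervals (hint α x) (hint x β),
      key α x (not_lt.1 h2) le_rfl, key2 x β (not_lt.1 h1) le_rfl]
    ring

theorem eventually_eps_lt {η δ : ℝ} (h : η < 1 / 16) :
    ∀ᶠ t : ℕ in Filter.atTop, eps η δ t < 1 / 2 := by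
  have h1 : Filter.Tendsto (fun t : ℕ => eps η δ t) Filter.atTop (nhds (8 * η + 12 * 0)) :=
    ((tendsto_const_div_atTop_nhds_zero_nat (Real.log (4 / δ))).const_mul 12).const_add _
  exact h1.eventually_lt_const (by linarith)

theorem le_eps {η δ : ℝ} (h0 : 0 < δ) (h1 : δ < 1) (t : ℕ) : 8 * η ≤ eps η δ t := by
  have : 0 ≤ Real.log (4 / δ) := Real.log_nonneg (by rw [le_div_iff₀ h0]; linarith)
  have : 0 ≤ Real.log (4 / δ) / t := by positivity
  unfold eps; linarith

theorem IsCorruption.card_fst_le {η : ℝ} {x y xc yc : ℕ → ℝ} (h : IsCorruption η x y xc yc) {t : ℕ}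
    (ht : 1 ≤ t) : (((Finset.Icc 1 t).filter fun j => xc j ≠ x j).card : ℝ) ≤ 2 * η * t :=
  (le_add_of_nonneg_right (Nat.cast_nonneg _)).trans (h t ht)

theorem IsCorruption.card_snd_le {η : ℝ} {x y xc yc : ℕ → ℝ} (h : IsCorruption η x y xc yc) {t : ℕ}
    (ht : 1 ≤ t) : (((Finset.Icc 1 t).filter fun j => yc j ≠ y j).card : ℝ) ≤ 2 * η * t :=
  (le_add_of_nonneg_left (Nat.cast_nonneg _)).trans (h t ht)

/-- If fewer than `6 η t` of the true samples lie beyond each of `a` and `b`, then the trimming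
values of the corrupted samples lie between `a` and `b`. -/
theorem eventually_trim_mem {η δ : ℝ} (h0 : 0 < δ) (h1 : δ < 1) (hη : 0 < η) (hη' : η < 1 / 16)
    {x y xc yc : ℕ → ℝ} (h : IsCorruption η x y xc yc) {a b : ℝ}
    (ha : ∀ᶠ t : ℕ in Filter.atTop, (((Finset.Icc 1 t).filter fun j => y j < a).card : ℝ) < 6 * η * t)
    (hb : ∀ᶠ t : ℕ in Filter.atTop,
      (((Finset.Icc 1 t).filter fun j => b < y j).card : ℝ) < 6 * η * t) :
    ∀ᶠ t : ℕ in Filter.atTop, a ≤ lowerTrim η δ yc t ∧ lowerTrim η δ yc t ≤ upperTrim η δ yc t ∧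
      upperTrim η δ yc t ≤ b := by
  filter_upwards [ha, hb, eventually_eps_lt (δ := δ) hη', Filter.eventually_ge_atTop 1]
    with t hat hbt het ht
  have ht' : (0 : ℝ) < t := by exact_mod_cast ht
  -- At least `8ηt` ranks are trimmed and at most `2ηt` values are corrupted, so a trimming value
  -- outside `[a, b]` would need `6ηt` true samples there.
  have he := mul_le_mul_of_nonneg_right (le_eps (η := η) h0 h1 t) ht'.le
  have hc := h.card_snd_le ht
  refine ⟨?_, orderStat_mono _ _ ?_, ?_⟩
  · by_contra! hlt
    have h2 := le_card_of_orderStat_lt ht (by nlinarith) hlt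
    have h3 := card_filter_le_add_card_ne y yc t (· < a)
    linarith
  · nlinarith
  · by_contra! hlt
    have h2 := le_card_of_lt_orderStat ht (mul_nonneg (by linarith) ht'.le) hlt
    have h3 := card_filter_le_add_card_ne y yc t (b < ·)
    nlinarith

end OrderStatistics

/-! ### Quantile bounds and the expected trimming gain under the law of the samples. -/

section Law

theorem integral_quadratic {α : Type*} {mα : MeasurableSpace α} {π : Measure α}
    [IsProbabilityMeasure π] {Z : α → ℝ} (hZ : MemLp Z 2 π) (p q r : ℝ) :
    ∫ x, (p * Z x ^ 2 + (q * Z x + r)) ∂π = p * ∫ x, Z x ^ 2 ∂π + (q * ∫ x, Z x ∂π + r) := by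
  have h1 : Integrable (fun x => q * Z x) π := (hZ.integrable one_le_two).const_mul _
  have h2 : Integrable (fun x => q * Z x + r) π := h1.add (integrable_const _)
  rw [integral_add (hZ.integrable_sq.const_mul _) h2, integral_add h1 (integrable_const _),
    integral_const_mul, integral_const_mul]
  simp

variable {ρ : Measure ℝ} [IsProbabilityMeasure ρ]

theorem continuous_cdf_of_nullSingletonClass [NullSingletonClass ρ] : Continuous (cdf ρ) := by
  rw [continuous_iff_continuousAt]
  intro x
  rw [(cdf ρ).mono.continuousAt_iff_leftLim_eq_rightLim, StieltjesFunction.rightLim_eq]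
  have h := (cdf ρ).measure_singleton x
  rw [measure_cdf, measure_singleton, eq_comm, ENNReal.ofReal_eq_zero] at h
  exact le_antisymm ((cdf ρ).mono.leftLim_le le_rfl) (by linarith)

theorem exists_real_Iic_eq [NullSingletonClass ρ] {κ : ℝ} (h0 : 0 < κ) (h1 : κ < 1) :
    ∃ q, ρ.real (Set.Iic q) = κ := by
  obtain ⟨c, hc⟩ := ((tendsto_cdf_atBot ρ).eventually_lt_const h0).exists
  obtain ⟨d, hd⟩ := ((tendsto_cdf_atTop ρ).eventually_const_lt h1).exists
  obtain ⟨q, hq⟩ := mem_range_of_exists_le_of_exists_ge (continuous_cdf_of_nullSingletonClass (ρ := ρ))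
    ⟨c, hc.le⟩ ⟨d, hd.le⟩
  exact ⟨q, by rw [← cdf_eq_real, hq]⟩

theorem variance_pos_of_nullSingletonClass [NullSingletonClass ρ] (h2 : MemLp id 2 ρ) : 0 < Var[id; ρ] := by
  refine (variance_nonneg _ _).lt_of_ne' fun h => ?_
  have h0 := (evariance_eq_zero_iff h2.aestronglyMeasurable.aemeasurable).1 (by
    rw [← h2.ofReal_variance_eq, h, ENNReal.ofReal_zero])
  have h3 : ∀ᵐ x ∂ρ, x ∈ ({∫ x, id x ∂ρ} : Set ℝ) := h0
  have h4 : ρ {∫ x, id x ∂ρ} = 1 := (mem_ae_iff_prob_eq_one (measurableSet_singleton _)).1 h3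
  simp at h4

/-- If `Z ≥ U ≥ 0` on an event of probability `κ`, where `Z` is centred, then
`κ U ^ 2 ≤ (1 - κ) Var Z`. -/
theorem one_sided_chebyshev {Z : ℝ → ℝ} (hZ : MemLp Z 2 ρ) (hZ0 : ∫ x, Z x ∂ρ = 0) {B : Set ℝ}
    (hB : MeasurableSet B) {κ U : ℝ} (hκ : ρ.real B = κ) (h0 : 0 ≤ κ) (h1 : κ < 1) (hU : 0 ≤ U)
    (h : ∀ x ∈ B, U ≤ Z x) : κ * U ^ 2 ≤ (∫ x, Z x ^ 2 ∂ρ) * (1 - κ) := by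
  -- Cantelli's shift: this `c` maximizes `κ (U + c)² - c²`, the resulting lower bound for the
  -- second moment.
  set c := κ * U / (1 - κ) with hc
  have hκ1 : 0 < 1 - κ := by linarith
  have hc0 : 0 ≤ c := by positivity
  have e1 : ∫ x, (Z x + c) ^ 2 ∂ρ = ∫ x, Z x ^ 2 ∂ρ + c ^ 2 := by
    have : ∀ x, (Z x + c) ^ 2 = 1 * Z x ^ 2 + (2 * c * Z x + c ^ 2) := fun x => by ring
    simp_rw [this]
    rw [integral_quadratic hZ, hZ0]
    simp
  have e2 : κ * (U + c) ^ 2 ≤ ∫ x, (Z x + c) ^ 2 ∂ρ := by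
    have : ∫ x, B.indicator (fun _ => (U + c) ^ 2) x ∂ρ = κ * (U + c) ^ 2 := by
      rw [integral_indicator hB, setIntegral_const, hκ, smul_eq_mul]
    rw [← this]
    refine integral_mono ((integrable_const _).indicator hB) ?_ fun x => ?_
    · exact (hZ.add (memLp_const c)).integrable_sq
    · by_cases hx : x ∈ B
      · rw [Set.indicator_of_mem hx]
        have := h x hx
        exact pow_le_pow_left₀ (by positivity) (by linarith) 2
      · rw [Set.indicator_of_notMem hx]; positivity
  have e3 : U + c = U / (1 - κ) := by rw [hc]; field_simp; ring
  rw [e1, e3, hc] at e2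
  have e4 : κ * (U / (1 - κ)) ^ 2 - (κ * U / (1 - κ)) ^ 2 = κ * U ^ 2 / (1 - κ) := by
    field_simp
  have e5 : κ * U ^ 2 / (1 - κ) ≤ ∫ x, Z x ^ 2 ∂ρ := by linarith
  rwa [div_le_iff₀ hκ1] at e5

theorem exists_quantile_bounds [NullSingletonClass ρ] (h2 : MemLp id 2 ρ) {κ : ℝ} (h0 : 0 < κ) (h1 : κ < 1) :
    ∃ U L : ℝ, 0 ≤ U ∧ 0 ≤ L ∧ ρ.real (Set.Ioi (∫ x, x ∂ρ + U)) ≤ κ ∧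
      ρ.real (Set.Iio (∫ x, x ∂ρ - L)) ≤ κ ∧ κ * U ^ 2 ≤ Var[id; ρ] * (1 - κ) ∧
      κ * L ^ 2 ≤ Var[id; ρ] * (1 - κ) ∧ κ * (U ^ 2 + L ^ 2) ≤ Var[id; ρ] := by
  obtain ⟨q, hq⟩ := exists_real_Iic_eq (ρ := ρ) (κ := 1 - κ) (by linarith) (by linarith)
  obtain ⟨p, hp⟩ := exists_real_Iic_eq (ρ := ρ) h0 h1
  have hq' : ρ.real (Set.Ioi q) = κ := by
    rw [← Set.compl_Iic, probReal_compl_eq_one_sub measurableSet_Iic, hq]; ring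
  set m := ∫ x, x ∂ρ with hm
  have hint : Integrable (fun x : ℝ => x) ρ := h2.integrable one_le_two
  have hvar : Var[id; ρ] = ∫ x, (x - m) ^ 2 ∂ρ := variance_eq_integral measurable_id.aemeasurable
  have hZ : MemLp (fun x => x - m) 2 ρ := h2.sub (memLp_const m)
  have hZ0 : ∫ x, (x - m) ∂ρ = 0 := by
    rw [integral_sub hint (integrable_const _)]; simp [hm]
  have hvar0 : 0 ≤ Var[id; ρ] := variance_nonneg _ _
  -- A quantile on the wrong side of the mean is replaced by the mean, which only shrinks the tail
  -- and makes its Chebyshev bound trivial.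
  refine ⟨max (q - m) 0, max (m - p) 0, le_max_right _ _, le_max_right _ _, ?_, ?_, ?_, ?_, ?_⟩
  · rw [← hq']
    exact measureReal_mono (Set.Ioi_subset_Ioi (by linarith [le_max_left (q - m) 0]))
  · rw [← hp]
    exact measureReal_mono fun x hx => by
      have : x < m - max (m - p) 0 := hx
      exact Set.mem_Iic.2 (by linarith [le_max_left (m - p) 0])
  · rcases le_total (q - m) 0 with h | h
    · rw [max_eq_right h]
      have : 0 ≤ Var[id; ρ] * (1 - κ) := mul_nonneg hvar0 (by linarith)
      simpa using this
    · rw [max_eq_left h, hvar]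
      exact one_sided_chebyshev hZ hZ0 measurableSet_Ioi hq' h0.le h1 h fun x hx => by
        have : q < x := hx
        linarith
  · rcases le_total (m - p) 0 with h | h
    · rw [max_eq_right h]
      have : 0 ≤ Var[id; ρ] * (1 - κ) := mul_nonneg hvar0 (by linarith)
      simpa using this
    · rw [max_eq_left h, hvar]
      have := one_sided_chebyshev (Z := fun x => -(x - m)) hZ.neg (by rw [integral_neg, hZ0, neg_zero])
        measurableSet_Iic hp h0.le h1 h fun x hx => by
          have : x ≤ p := hx
          linarith
      simpa only [neg_sq] using this
  · have e1 : ∫ x, ((Set.Ioi q).indicator (fun _ => max (q - m) 0 ^ 2) x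
        + (Set.Iic p).indicator (fun _ => max (m - p) 0 ^ 2) x) ∂ρ
        = κ * (max (q - m) 0 ^ 2 + max (m - p) 0 ^ 2) := by
      rw [integral_add ((integrable_const _).indicator measurableSet_Ioi)
        ((integrable_const _).indicator measurableSet_Iic), integral_indicator measurableSet_Ioi,
        integral_indicator measurableSet_Iic, setIntegral_const, setIntegral_const, hq', hp]
      simp only [smul_eq_mul]; ring
    -- The integrand is pointwise at most `(x - m)²`: if both maxima are positive then `p < m < q`,
    -- and the two indicators have disjoint supports.
    rw [← e1, hvar]
    refine integral_mono (((integrable_const _).indicator measurableSet_Ioi).add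
      ((integrable_const _).indicator measurableSet_Iic)) hZ.integrable_sq fun x => ?_
    simp only [Set.indicator_apply, Set.mem_Ioi, Set.mem_Iic]
    rcases le_total (q - m) 0 with h | h <;> rcases le_total (m - p) 0 with h' | h' <;>
      simp only [h, h', max_eq_left, max_eq_right] <;> split_ifs <;> nlinarith

variable {V : Type*} [Fintype V]

/-- The largest value of `∑ i, g i * trim α β (x i)` over `a ≤ α ≤ β ≤ b` is at most this. -/
def trimGain (g : V → ℝ) (a b : ℝ) (x : V → ℝ) : ℝ :=
  ∫ u in a..b, max (∑ i, g i * if u < x i then (1 : ℝ) else 0) 0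

theorem measurable_gain (g : V → ℝ) : Measurable fun p : (V → ℝ) × ℝ =>
    max (∑ i, g i * if p.2 < p.1 i then (1 : ℝ) else 0) 0 := by
  refine Measurable.max (Finset.measurable_sum _ fun i _ => ?_) measurable_const
  refine Measurable.const_mul (Measurable.ite ?_ measurable_const measurable_const) _
  exact measurableSet_lt measurable_snd ((measurable_pi_apply i).comp measurable_fst)

theorem gain_le (g x : V → ℝ) (u : ℝ) :
    max (∑ i, g i * if u < x i then (1 : ℝ) else 0) 0 ≤ ∑ i, |g i| := by
  refine max_le (Finset.sum_le_sum fun i _ => ?_) (Finset.sum_nonneg fun i _ => abs_nonneg _)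
  split_ifs
  · simpa using le_abs_self (g i)
  · simp

theorem intervalIntegrable_gain (g x : V → ℝ) (a b : ℝ) : IntervalIntegrable
    (fun u => max (∑ i, g i * if u < x i then (1 : ℝ) else 0) 0) volume a b := by
  refine (intervalIntegrable_const (c := ∑ i, |g i|)).mono_fun ?_ ?_
  · exact ((measurable_gain g).comp (measurable_const.prodMk measurable_id)).aestronglyMeasurable
  · refine Filter.Eventually.of_forall fun u => ?_
    dsimp only
    rw [Real.norm_of_nonneg (le_max_right _ _)]
    exact (gain_le g x u).trans (le_abs_self _)

theorem trimGain_nonneg (g : V → ℝ) {a b : ℝ} (hab : a ≤ b) (x : V → ℝ) : 0 ≤ trimGain g a b x :=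
  intervalIntegral.integral_nonneg hab fun _ _ => le_max_right _ _

theorem trimGain_le (g : V → ℝ) {a b : ℝ} (hab : a ≤ b) (x : V → ℝ) :
    trimGain g a b x ≤ (∑ i, |g i|) * (b - a) := by
  have := intervalIntegral.integral_mono_on hab (intervalIntegrable_gain g x a b)
    (intervalIntegrable_const (c := ∑ i, |g i|)) fun u _ => gain_le g x u
  simpa [trimGain, mul_comm] using this

theorem measurable_trimGain (g : V → ℝ) {a b : ℝ} (hab : a ≤ b) :
    Measurable (trimGain g a b) := by
  have : trimGain g a b = fun x => ∫ u, max (∑ i, g i * if u < x i then (1 : ℝ) else 0) 0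
      ∂(volume.restrict (Set.Ioc a b)) := by
    ext x; rw [trimGain, intervalIntegral.integral_of_le hab]
  rw [this]
  exact (measurable_gain g).stronglyMeasurable.integral_prod_right.measurable

/-- Zero total weight kills the constant `α` of the layer-cake formula; after passing to the
positive part, the interval may be enlarged to `[a, b]`. -/
theorem sum_mul_trim_le (g : V → ℝ) (hg : ∑ i, g i = 0) {a b α β : ℝ} (ha : a ≤ α) (hαβ : α ≤ β)
    (hb : β ≤ b) (x : V → ℝ) : ∑ i, g i * trim α β (x i) ≤ trimGain g a b x := by
  have hint : ∀ i, IntervalIntegrable (fun u => g i * if u < x i then (1 : ℝ) else 0)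
      volume α β := fun i => by
    refine (intervalIntegrable_const (c := |g i|)).mono_fun ?_ ?_
    · exact (Measurable.const_mul (Measurable.ite measurableSet_Iio measurable_const
        measurable_const) _).aestronglyMeasurable
    · refine Filter.Eventually.of_forall fun u => ?_
      dsimp only
      split_ifs <;> simp
  have h1 : ∑ i, g i * trim α β (x i)
      = ∫ u in α..β, ∑ i, g i * if u < x i then (1 : ℝ) else 0 := by
    rw [intervalIntegral.integral_finsetSum fun i _ => hint i]
    simp_rw [trim_eq_add_integral hαβ, mul_add, Finset.sum_add_distrib, ← Finset.sum_mul, hg,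
      zero_mul, zero_add, intervalIntegral.integral_const_mul]
  rw [h1]
  calc ∫ u in α..β, ∑ i, g i * (if u < x i then (1 : ℝ) else 0)
      ≤ ∫ u in α..β, max (∑ i, g i * if u < x i then (1 : ℝ) else 0) 0 :=
        intervalIntegral.integral_mono_on hαβ
          (by simpa [Finset.sum_fn] using IntervalIntegrable.sum Finset.univ fun i _ => hint i)
          (intervalIntegrable_gain g x α β) fun u _ => le_max_left _ _
    _ ≤ trimGain g a b x :=
        intervalIntegral.integral_mono_interval ha hαβ hb
          (Filter.Eventually.of_forall fun u => le_max_right _ _) (intervalIntegrable_gain g x a b)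

/-- The combination of indicators is centred because `g` sums to zero, and by independence its
variance is at most `∑ g i ^ 2 / 4`. -/
theorem integral_gain_le (g : V → ℝ) (hg : ∑ i, g i = 0) (u : ℝ) :
    ∫ x, max (∑ i, g i * if u < x i then (1 : ℝ) else 0) 0 ∂(Measure.pi fun _ : V => ρ)
      ≤ √(∑ i, g i ^ 2) / 4 := by
  set π := Measure.pi fun _ : V => ρ with hπ
  set ν := √(∑ i, g i ^ 2) with hν
  have hν2 : ν ^ 2 = ∑ i, g i ^ 2 := Real.sq_sqrt (Finset.sum_nonneg fun i _ => sq_nonneg _)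
  set f : ℝ → ℝ := fun t => if u < t then 1 else 0 with hf
  have hfm : Measurable f := Measurable.ite measurableSet_Ioi measurable_const measurable_const
  have hf01 : ∀ t, f t ∈ Set.Icc (0 : ℝ) 1 := fun t => by
    simp only [hf]; split_ifs <;> simp
  have hfL : ∀ i : V, MemLp (fun t => g i * f t) 2 ρ := fun i => by
    refine MemLp.of_bound (hfm.const_mul _).aestronglyMeasurable |g i|
      (Filter.Eventually.of_forall fun t => ?_)
    rw [norm_mul, Real.norm_eq_abs, Real.norm_of_nonneg (hf01 t).1]
    exact mul_le_of_le_one_right (abs_nonneg _) (hf01 t).2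
  set J : (V → ℝ) → ℝ := fun x => ∑ i, g i * f (x i) with hJ
  have hJL : MemLp J 2 π := memLp_finsetSum _ fun i _ =>
    (hfL i).comp_measurePreserving (measurePreserving_eval (fun _ : V => ρ) i)
  have hJ0 : ∫ x, J x ∂π = 0 := by
    have hint : ∀ i, Integrable (fun x : V → ℝ => g i * f (x i)) π := fun i =>
      ((hfL i).comp_measurePreserving
        (measurePreserving_eval (fun _ : V => ρ) i)).integrable one_le_two
    rw [hJ, integral_finsetSum _ fun i _ => hint i]
    have : ∀ i, ∫ x : V → ℝ, g i * f (x i) ∂π = g i * ∫ t, f t ∂ρ := fun i => by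
      rw [integral_const_mul, ← (measurePreserving_eval (fun _ : V => ρ) i).map_eq,
        integral_map (measurable_pi_apply i).aemeasurable hfm.aestronglyMeasurable]
    simp_rw [this]
    rw [← Finset.sum_mul, hg, zero_mul]
  have hJ2 : ∫ x, J x ^ 2 ∂π ≤ ν ^ 2 / 4 := by
    have h1 := variance_sum_pi (μ := fun _ : V => ρ) hfL
    have h2 : (∑ i, fun x : V → ℝ => g i * f (x i)) = J := by ext x; simp [hJ]
    rw [h2, variance_eq_integral hJL.aestronglyMeasurable.aemeasurable, hJ0] at h1
    simp only [sub_zero] at h1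
    rw [h1, hν2, Finset.sum_div]
    refine Finset.sum_le_sum fun i _ => ?_
    rw [variance_const_mul]
    have := variance_le_sq_of_bounded (μ := ρ) (Filter.Eventually.of_forall hf01) hfm.aemeasurable
    nlinarith [sq_nonneg (g i)]
  have hint1 := hJL.integrable one_le_two
  have hint2 := hJL.integrable_sq
  rcases (Real.sqrt_nonneg _).eq_or_lt with h0 | h0
  · have hg0 : ∀ i, g i = 0 := by
      have : ∑ i, g i ^ 2 = 0 := by rw [← hν2, hν, ← h0]; simp
      intro i
      have := (Finset.sum_eq_zero_iff_of_nonneg fun i _ => sq_nonneg (g i)).1 this i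
        (Finset.mem_univ i)
      exact pow_eq_zero_iff two_ne_zero |>.1 this
    simp only [hg0, zero_mul, Finset.sum_const_zero, max_self, integral_zero]
    positivity
  · rw [← hν] at h0
    -- The parabola `(2J + ν)² / (8ν)` dominates the positive part of `J`, touching it at `J = ν/2`
    -- and `J = -ν/2`.
    calc ∫ x, max (J x) 0 ∂π ≤ ∫ x, (1 / (2 * ν) * J x ^ 2 + (1 / 2 * J x + ν / 8)) ∂π := by
          refine integral_mono ((hint1.sup (integrable_zero _ _ _)))
            ((hint2.const_mul _).add ((hint1.const_mul _).add (integrable_const _))) fun x => ?_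
          have e : 1 / (2 * ν) * J x ^ 2 + (1 / 2 * J x + ν / 8) = (2 * J x + ν) ^ 2 / (8 * ν) := by
            field_simp; ring
          dsimp only
          rw [e, le_div_iff₀ (by positivity)]
          rcases le_total (J x) 0 with h | h
          · rw [max_eq_right h]; nlinarith [sq_nonneg (2 * J x + ν)]
          · rw [max_eq_left h]; nlinarith [sq_nonneg (2 * J x - ν)]
      _ = 1 / (2 * ν) * ∫ x, J x ^ 2 ∂π + ν / 8 := by
          rw [integral_quadratic hJL, hJ0]
          simp
      _ ≤ 1 / (2 * ν) * (ν ^ 2 / 4) + ν / 8 := by gcongr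
      _ = ν / 4 := by field_simp; ring

theorem integral_trimGain_le (g : V → ℝ) (hg : ∑ i, g i = 0) {a b : ℝ} (hab : a ≤ b) :
    ∫ x, trimGain g a b x ∂(Measure.pi fun _ : V => ρ) ≤ √(∑ i, g i ^ 2) / 4 * (b - a) := by
  have h1 : ∀ x, trimGain g a b x = ∫ u, max (∑ i, g i * if u < x i then (1 : ℝ) else 0) 0
      ∂(volume.restrict (Set.Ioc a b)) := fun x => by
    rw [trimGain, intervalIntegral.integral_of_le hab]
  have hint : Integrable (Function.uncurry fun (x : V → ℝ) (u : ℝ) =>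
      max (∑ i, g i * if u < x i then (1 : ℝ) else 0) 0)
      ((Measure.pi fun _ : V => ρ).prod (volume.restrict (Set.Ioc a b))) := by
    refine Integrable.of_bound (measurable_gain g).aestronglyMeasurable (∑ i, |g i|)
      (Filter.Eventually.of_forall fun p => ?_)
    rw [Function.uncurry, Real.norm_of_nonneg (le_max_right _ _)]
    exact gain_le g p.1 p.2
  simp_rw [h1]
  rw [integral_integral_swap hint]
  calc ∫ u, ∫ x, max (∑ i, g i * if u < x i then (1 : ℝ) else 0) 0 ∂(Measure.pi fun _ : V => ρ)
        ∂(volume.restrict (Set.Ioc a b))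
      ≤ ∫ u, √(∑ i, g i ^ 2) / 4 ∂(volume.restrict (Set.Ioc a b)) :=
        integral_mono hint.integral_prod_right (integrable_const _) fun u => integral_gain_le g hg u
    _ = √(∑ i, g i ^ 2) / 4 * (b - a) := by
        simp [hab, mul_comm]

end Law

/-! ### Laws of large numbers along a path, with corruption. -/

section LargeNumbers

open Filter Topology

variable {Ω : Type*} {mΩ : MeasurableSpace Ω} {P : Measure Ω} [IsProbabilityMeasure P]

theorem ae_tendsto_average {E : Type*} [MeasurableSpace E] {ν : Measure E} {Z : ℕ → Ω → E}
    (hZ : ∀ j, AEMeasurable (Z j) P) (hlaw : ∀ j, P.map (Z j) = ν)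
    (hind : Pairwise fun i j => IndepFun (Z i) (Z j) P) {f : E → ℝ} (hf : Measurable f) {C : ℝ}
    (hC : ∀ e, |f e| ≤ C) :
    ∀ᵐ ω ∂P, Tendsto (fun n : ℕ => (∑ j ∈ Finset.range n, f (Z j ω)) / n) atTop
      (𝓝 (∫ e, f e ∂ν)) := by
  have h := strong_law_ae_real (μ := P) (fun j ω => f (Z j ω))
    (Integrable.of_bound (hf.comp_aemeasurable (hZ 0)).aestronglyMeasurable C
      (Eventually.of_forall fun ω => hC _))
    (fun i j hij => (hind hij).comp hf hf)
    (fun j => (IdentDistrib.mk (hZ j) (hZ 0) ((hlaw j).trans (hlaw 0).symm)).comp hf)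
  have e : ∫ ω, f (Z 0 ω) ∂P = ∫ e, f e ∂ν := by
    rw [← hlaw 0, integral_map (hZ 0) hf.aestronglyMeasurable]
  rw [e] at h
  exact h

theorem eventually_card_lt {y : ℕ → ℝ} {A : Set ℝ} [DecidablePred (· ∈ A)] {κ κ' : ℝ}
    (h : Tendsto (fun n : ℕ => (∑ j ∈ Finset.range n, A.indicator (fun _ => (1 : ℝ)) (y (j + 1))) / n)
      atTop (𝓝 κ)) (hκ : κ < κ') :
    ∀ᶠ t : ℕ in atTop, (((Finset.Icc 1 t).filter fun j => y j ∈ A).card : ℝ) < κ' * t := by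
  filter_upwards [h.eventually_lt_const hκ, eventually_ge_atTop 1] with t ht h1
  have ht0 : (0 : ℝ) < t := by exact_mod_cast h1
  rw [div_lt_iff₀ ht0] at ht
  refine lt_of_eq_of_lt ?_ ht
  rw [Finset.card_filter, Nat.cast_sum, Finset.range_eq_Ico,
    Finset.sum_Ico_add' (fun j => A.indicator (fun _ => (1 : ℝ)) (y j)) 0 t 1]
  refine Finset.sum_congr (by ext; simp) fun j _ => ?_
  by_cases hj : y j ∈ A <;> simp [hj]

variable {V : Type*} [Fintype V]

theorem ae_tendsto_average_of_iIndepFun [DecidableEq V] {ρ : Measure ℝ} {x : V × ℕ → Ω → ℝ}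
    (hx : ∀ q, AEMeasurable (x q) P) (hlaw : ∀ q, P.map (x q) = ρ) (hind : iIndepFun x P)
    {f : (V → ℝ) → ℝ} (hf : Measurable f) {C : ℝ} (hC : ∀ e, |f e| ≤ C) :
    ∀ᵐ ω ∂P, Tendsto (fun n : ℕ => (∑ j ∈ Finset.range n, f fun i => x (i, j) ω) / n) atTop
      (𝓝 (∫ e, f e ∂(Measure.pi fun _ : V => ρ))) := by
  refine ae_tendsto_average (Z := fun j ω i => x (i, j) ω)
    (fun j => aemeasurable_pi_lambda _ fun i => hx (i, j)) (fun j => ?_) (fun j k hjk => ?_) hf hC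
  · have h1 : iIndepFun (fun i => x (i, j)) P :=
      hind.precomp (g := fun i : V => (i, j)) fun a b h => (Prod.ext_iff.1 h).1
    rw [(iIndepFun_iff_map_fun_eq_pi_map fun i => hx (i, j)).1 h1]
    simp_rw [hlaw]
  · set S : ℕ → Finset (V × ℕ) := fun j => Finset.univ ×ˢ {j} with hS
    have hd : Disjoint (S j) (S k) := by
      rw [Finset.disjoint_left]
      intro p hp hq
      simp only [hS, Finset.mem_product, Finset.mem_singleton, Finset.mem_univ, true_and] at hp hq
      exact hjk (hp.symm.trans hq)
    have h1 := hind.indepFun_finset₀ (S j) (S k) hd hx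
    have hmem : ∀ j i, (i, j) ∈ S j := fun j i => by simp [hS]
    exact h1.comp (φ := fun (z : S j → ℝ) (i : V) => z ⟨(i, j), hmem j i⟩)
      (ψ := fun (z : S k → ℝ) (i : V) => z ⟨(i, k), hmem k i⟩)
      (measurable_pi_lambda _ fun i => measurable_pi_apply _)
      (measurable_pi_lambda _ fun i => measurable_pi_apply _)

/-- On a path along which the averages of `trimGain` converge, a zero sum combination of the
trimmed corrupted samples cannot stay above the limit plus the corruption budget. -/
theorem frequently_sum_mul_trim_lt {g : V → ℝ} (hg : ∑ i, g i = 0) {a b η E ζ : ℝ} (hab : a ≤ b)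
    {x y xc yc : V → ℕ → ℝ} (hc : ∀ i, IsCorruption η (x i) (y i) (xc i) (yc i)) {α β : ℕ → ℝ}
    (hαβ : ∀ᶠ t in atTop, a ≤ α t ∧ α t ≤ β t ∧ β t ≤ b)
    (hE : Tendsto (fun n : ℕ => (∑ j ∈ Finset.range n, trimGain g a b fun i => x i (j + 1)) / n)
      atTop (𝓝 E)) (hζ : E + 2 * η * (∑ i, |g i|) * (b - a) < ζ) :
    ∃ᶠ t in atTop, ∑ i, g i * trim (α t) (β t) (xc i t) < ζ := by
  intro hcon
  obtain ⟨t0, ht0⟩ := eventually_atTop.1 (hcon.and hαβ)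
  have hpt : ∀ t, max t0 1 ≤ t → ζ ≤ (trimGain g a b fun i => x i t)
      + ∑ i, |g i| * (b - a) * if xc i t ≠ x i t then 1 else 0 := by
    intro t ht
    obtain ⟨h1, h2, h3, h4⟩ := ht0 t ((le_max_left _ _).trans ht)
    refine (not_lt.1 h1).trans ?_
    have h5 := sum_mul_trim_le g hg h2 h3 h4 fun i => x i t
    -- Both trimmed values lie in `[a, b]`, so a corrupted sample costs at most `|g i| (b - a)`; the
    -- budget of `2ηn` corruptions per agent then bounds the accumulated cost.
    have h6 : ∑ i, g i * trim (α t) (β t) (xc i t) - ∑ i, g i * trim (α t) (β t) (x i t)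
        ≤ ∑ i, |g i| * (b - a) * if xc i t ≠ x i t then 1 else 0 := by
      rw [← Finset.sum_sub_distrib]
      refine Finset.sum_le_sum fun i _ => ?_
      split_ifs with h
      · obtain ⟨h7, h8⟩ := trim_mem_Icc h3 (xc i t)
        obtain ⟨h9, h10⟩ := trim_mem_Icc h3 (x i t)
        rw [← mul_sub, mul_one]
        refine (le_abs_self _).trans ?_
        rw [abs_mul]
        refine mul_le_mul_of_nonneg_left ?_ (abs_nonneg _)
        rw [abs_le]
        constructor <;> linarith
      · rw [not_not.1 h]; simp
    linarith
  have hsum : ∀ n : ℕ, max t0 1 ≤ n → ζ * (n - (max t0 1 : ℕ)) ≤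
      (∑ j ∈ Finset.range n, trimGain g a b fun i => x i (j + 1))
        + 2 * η * (∑ i, |g i|) * (b - a) * n := by
    intro n hn
    have h1 : ∀ t ∈ Finset.Icc 1 n, (0 : ℝ) ≤ (trimGain g a b fun i => x i t)
        + ∑ i, |g i| * (b - a) * if xc i t ≠ x i t then 1 else 0 := fun t _ => by
      refine add_nonneg (trimGain_nonneg g hab _) (Finset.sum_nonneg fun i _ => ?_)
      refine mul_nonneg (mul_nonneg (abs_nonneg _) (by linarith)) ?_
      split_ifs <;> norm_num
    calc ζ * (n - (max t0 1 : ℕ)) = ∑ t ∈ Finset.Ioc (max t0 1) n, ζ := by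
          rw [Finset.sum_const, Nat.card_Ioc, nsmul_eq_mul, Nat.cast_sub hn]; ring
      _ ≤ ∑ t ∈ Finset.Ioc (max t0 1) n, ((trimGain g a b fun i => x i t)
        + ∑ i, |g i| * (b - a) * if xc i t ≠ x i t then 1 else 0) :=
          Finset.sum_le_sum fun t ht => hpt t (Finset.mem_Ioc.1 ht).1.le
      _ ≤ ∑ t ∈ Finset.Icc 1 n, ((trimGain g a b fun i => x i t)
        + ∑ i, |g i| * (b - a) * if xc i t ≠ x i t then 1 else 0) := by
          refine Finset.sum_le_sum_of_subset_of_nonneg (fun t ht => ?_) fun t ht _ => h1 t ht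
          rw [Finset.mem_Ioc] at ht
          rw [Finset.mem_Icc]
          exact ⟨((le_max_right t0 1).trans_lt ht.1).le, ht.2⟩
      _ = (∑ j ∈ Finset.range n, trimGain g a b fun i => x i (j + 1))
        + ∑ i, |g i| * (b - a) * ((Finset.Icc 1 n).filter fun t => xc i t ≠ x i t).card := by
          rw [Finset.sum_add_distrib, Finset.sum_comm (s := Finset.Icc 1 n)]
          congr 1
          · rw [Finset.range_eq_Ico, Finset.sum_Ico_add' (fun j => trimGain g a b fun i => x i j)]
            exact Finset.sum_congr (by ext; simp) fun _ _ => rfl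
          · refine Finset.sum_congr rfl fun i _ => ?_
            rw [← Finset.mul_sum, Finset.card_filter, Nat.cast_sum]
            simp
      _ ≤ (∑ j ∈ Finset.range n, trimGain g a b fun i => x i (j + 1))
        + ∑ i, |g i| * (b - a) * (2 * η * n) := by
          refine add_le_add le_rfl (Finset.sum_le_sum fun i _ => mul_le_mul_of_nonneg_left ?_
            (mul_nonneg (abs_nonneg _) (sub_nonneg.2 hab)))
          exact (hc i).card_fst_le ((le_max_right _ _).trans hn)
      _ = _ := by rw [← Finset.sum_mul, ← Finset.sum_mul]; ring
  have hlim1 : Tendsto (fun n : ℕ => ζ - ζ * (max t0 1 : ℕ) / (n : ℝ)) atTop (𝓝 (ζ - 0)) :=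
    (tendsto_const_div_atTop_nhds_zero_nat _).const_sub _
  have hlim2 := hE.add_const (2 * η * (∑ i, |g i|) * (b - a))
  refine absurd (le_of_tendsto_of_tendsto hlim1 hlim2 ?_) (by simpa using hζ)
  filter_upwards [eventually_ge_atTop (max t0 1)] with n hn
  have hn0 : (0 : ℝ) < n := by exact_mod_cast (le_max_right t0 1).trans hn
  have h := hsum n hn
  rw [← sub_nonneg]
  have e : (∑ j ∈ Finset.range n, trimGain g a b fun i => x i (j + 1)) / n
      + 2 * η * (∑ i, |g i|) * (b - a) - (ζ - ζ * (max t0 1 : ℕ) / (n : ℝ))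
      = ((∑ j ∈ Finset.range n, trimGain g a b fun i => x i (j + 1))
        + 2 * η * (∑ i, |g i|) * (b - a) * n - ζ * (n - (max t0 1 : ℕ))) / n := by
    field_simp
  rw [e]
  exact div_nonneg (by linarith) hn0.le

end LargeNumbers

/-! ### The recursion for the scaled error and the choice of a good time. -/

section Dynamics

open Filter Topology

variable {V : Type*} [Fintype V] [DecidableEq V]

theorem norm_le_add_sum_norm {S : Matrix V V ℝ} (hS : IsStochastic S) {z b : ℕ → V → ℝ}
    (hz : ∀ t, z (t + 1) = S.mulVec (z t + b (t + 1))) {t₀ t : ℕ} (h : t₀ ≤ t) :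
    ‖z t‖ ≤ ‖z t₀‖ + ∑ j ∈ Finset.Icc (t₀ + 1) t, ‖b j‖ := by
  induction t, h using Nat.le_induction with
  | base => simp
  | succ t ht ih =>
    rw [hz, Finset.sum_Icc_succ_top (by omega), ← add_assoc]
    exact (hS.norm_mulVec_le _).trans ((norm_add_le _ _).trans (by gcongr))

theorem norm_le_abs_average_add_osc [Nonempty V] (v : V → ℝ) :
    ‖v‖ ≤ |(∑ i, v i) / Fintype.card V| + osc v := by
  have hc : (Fintype.card V : ℝ) ≠ 0 := by exact_mod_cast Fintype.card_ne_zero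
  have := norm_le_abs_sum_add_osc v (fun _ => 1 / (Fintype.card V : ℝ)) (fun _ => by positivity)
    (by simp [hc])
  rw [← Finset.mul_sum] at this
  rwa [div_eq_inv_mul, ← one_div]

/-- If communication contracts the accumulated oscillation and the new samples are controlled by
`A`, then at some time the disagreement is dominated by a multiple of the next `A` and the slack. -/
theorem exists_norm_le_of_contraction [Nonempty V] {S W : Matrix V V ℝ} (hS : IsStochastic S)
    (hW : IsStochastic W) {N : ℕ} (hN : 0 < N) {r : ℝ} (hr0 : 0 < r) (hr1 : r < 1)
    (hO : ∀ v, accOsc W N (S.mulVec v) ≤ r * accOsc W N v) {z b : ℕ → V → ℝ}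
    (hz : ∀ t, z (t + 1) = S.mulVec (z t + b (t + 1))) {s A : ℕ → ℝ} {ε M : ℝ} (hε : 0 < ε)
    (hbs : ∀ᶠ t in atTop, ‖b t‖ + ε ≤ s t) (hA : ∀ᶠ t in atTop, osc (b t) ≤ 2 * A t)
    (hM : 2 * N / (1 - r) ≤ M) :
    ∃ t₀, ∀ t, t₀ + 2 ≤ t → ‖z t‖ ≤ |(∑ i, (z t₀ + b (t₀ + 1)) i) / Fintype.card V|
      + ∑ j ∈ Finset.Icc (t₀ + 2) t, s j + 2 * M * A (t₀ + 2) := by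
  obtain ⟨k, hk⟩ := eventually_atTop.1 (hbs.and hA)
  have hN' : (0 : ℝ) < N := by exact_mod_cast hN
  have hr' : 0 < 1 - r := by linarith
  have hM0 : 0 < M := lt_of_lt_of_le (by positivity) hM
  set Y : ℕ → ℝ := fun t => accOsc W N (z t + b (t + 1)) with hY
  have hex : ∃ t ≥ k, Y t ≤ 2 * M * A (t + 2) + ε := by
    by_contra! hcon
    -- While `Y t` exceeds the target, `2N ≤ M (1 - r)` bounds the new input by half of the
    -- contraction gain. Then `Y` decays geometrically and falls below `ε`.
    have hstep : ∀ t ≥ k, Y (t + 1) ≤ (1 + r) / 2 * Y t := by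
      intro t ht
      have h1 : Y (t + 1) ≤ r * Y t + N * (2 * A (t + 2)) := by
        refine (accOsc_add_le W N _ _).trans (add_le_add ?_ ?_)
        · rw [hz]; exact hO _
        · exact (accOsc_le hW N _).trans
            (mul_le_mul_of_nonneg_left (hk (t + 2) (by omega)).2 hN'.le)
      have h2 := hcon t ht
      have h3 : 2 * N ≤ M * (1 - r) := by rwa [div_le_iff₀ hr'] at hM
      have h4 : 0 ≤ A (t + 2) := by
        have := (osc_nonneg (b (t + 2))).trans (hk (t + 2) (by omega)).2
        linarith
      nlinarith
    have hgeom : ∀ n, Y (k + n) ≤ ((1 + r) / 2) ^ n * Y k := by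
      intro n
      induction n with
      | zero => simp
      | succ n ih =>
        refine (hstep (k + n) (by omega)).trans ?_
        rw [pow_succ', mul_assoc]
        exact mul_le_mul_of_nonneg_left ih (by linarith)
    have hlim : Tendsto (fun n : ℕ => ((1 + r) / 2) ^ n * Y k) atTop (𝓝 (0 * Y k)) :=
      (tendsto_pow_atTop_nhds_zero_of_lt_one (by linarith) (by linarith)).mul_const _
    rw [zero_mul] at hlim
    obtain ⟨n, hn⟩ := (hlim.eventually_lt_const hε).exists
    have h1 := hcon (k + n) (by omega)
    have h4 : 0 ≤ A (k + n + 2) := by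
      have := (osc_nonneg (b (k + n + 2))).trans (hk (k + n + 2) (by omega)).2
      linarith
    have h5 : 0 ≤ 2 * M * A (k + n + 2) := by positivity
    linarith [hgeom n]
  obtain ⟨t₀, ht₀, hY₀⟩ := hex
  refine ⟨t₀, fun t ht => ?_⟩
  have h1 := norm_le_add_sum_norm hS hz (show t₀ + 1 ≤ t by omega)
  have h2 : ∑ j ∈ Finset.Icc (t₀ + 2) t, (‖b j‖ + ε) ≤ ∑ j ∈ Finset.Icc (t₀ + 2) t, s j :=
    Finset.sum_le_sum fun j hj => (hk j (by rw [Finset.mem_Icc] at hj; omega)).1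
  rw [Finset.sum_add_distrib, Finset.sum_const, nsmul_eq_mul, Nat.card_Icc] at h2
  -- Since `t ≥ t₀ + 2`, the sum contains at least one slack `ε`, which absorbs the `ε` in the
  -- choice of `t₀`.
  have h3 : ε ≤ (t + 1 - (t₀ + 2) : ℕ) * ε :=
    le_mul_of_one_le_left hε.le (by exact_mod_cast (by omega))
  have h4 : ‖z (t₀ + 1)‖ ≤ |(∑ i, (z t₀ + b (t₀ + 1)) i) / Fintype.card V| + Y t₀ := by
    rw [hz]
    exact (hS.norm_mulVec_le _).trans ((norm_le_abs_average_add_osc _).trans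
      (add_le_add_right (osc_le_accOsc W hN _) _))
  linarith

/-- If communication is strong and no sign of the combination `∑ i, g i * b t i`, where `g` is the
difference of the stationary and the uniform weights, persistently dominates, then at some time
the largest estimate is dominated by the uniform average of the estimates before communication. -/
theorem exists_norm_le_of_mixing [Nonempty V] {S : Matrix V V ℝ} (hS : IsStochastic S) {θ : ℝ}
    (hθ0 : 0 ≤ θ) (hθ : θ ≤ 1 / 4000) (hosc : ∀ v, osc (S.mulVec v) ≤ θ * osc v) {p : V → ℝ}
    (hp0 : ∀ i, 0 ≤ p i) (hp1 : ∑ i, p i = 1)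
    (hp : ∀ v, ∑ i, p i * S.mulVec v i = ∑ i, p i * v i) {z b : ℕ → V → ℝ}
    (hz : ∀ t, z (t + 1) = S.mulVec (z t + b (t + 1))) {s : ℕ → ℝ} {s₀ B : ℝ} (hs₀ : 0 < s₀)
    (hs : Tendsto s atTop (𝓝 s₀)) (hB : B < s₀) (hbs : ∀ᶠ t in atTop, ‖b t‖ ≤ s t)
    (hbB : ∀ᶠ t in atTop, ‖b t‖ ≤ B)
    (hpos : ∃ᶠ t in atTop, ∑ i, (p i - 1 / Fintype.card V) * b t i < 0.997 * s₀ - B)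
    (hneg : ∃ᶠ t in atTop, ∑ i, -(p i - 1 / Fintype.card V) * b t i < 0.997 * s₀ - B) :
    ∃ t₀, ∀ t, t₀ + 2 ≤ t → ‖z t‖ ≤ |(∑ i, (z t₀ + b (t₀ + 1)) i) / Fintype.card V|
      + ∑ j ∈ Finset.Icc (t₀ + 2) t, s j := by
  set m : ℝ := (Fintype.card V : ℝ) with hm
  have hm0 : m ≠ 0 := by rw [hm]; exact_mod_cast Fintype.card_ne_zero
  have hoscb : ∀ t, ‖b t‖ ≤ B → osc (b t) ≤ 2 * s₀ := fun t ht =>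
    osc_le (by linarith) fun i j => by
      have h1 := (norm_le_pi_norm (b t) i).trans ht
      have h2 := (norm_le_pi_norm (b t) j).trans ht
      rw [Real.norm_eq_abs] at h1 h2
      exact (abs_sub _ _).trans (by linarith)
  -- Each step multiplies the oscillation by at most `1/4000` after adding at most `2 s₀`, so the
  -- initial value is forgotten.
  have hzosc : ∀ᶠ t in atTop, osc (z t) ≤ s₀ / 1000 := by
    obtain ⟨k, hk⟩ := eventually_atTop.1 hbB
    have hgeom : ∀ n, osc (z (k + n)) ≤ (1 / 4 : ℝ) ^ n * osc (z k) + s₀ / 1500 := by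
      intro n
      induction n with
      | zero => simp only [add_zero, pow_zero, one_mul]; linarith
      | succ n ih =>
        have h1 : osc (z (k + n + 1)) ≤ θ * (osc (z (k + n)) + 2 * s₀) := by
          rw [hz]
          refine (hosc _).trans (mul_le_mul_of_nonneg_left ?_ hθ0)
          exact (osc_add_le _ _).trans (add_le_add_right (hoscb _ (hk _ (by omega))) _)
        have h2 := osc_nonneg (z (k + n))
        have h3 : θ * (osc (z (k + n)) + 2 * s₀) ≤ 1 / 4000 * (osc (z (k + n)) + 2 * s₀) :=
          mul_le_mul_of_nonneg_right hθ (by linarith)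
        rw [pow_succ', mul_assoc, ← add_assoc]
        linarith
    have hlim : Tendsto (fun n : ℕ => (1 / 4 : ℝ) ^ n * osc (z k)) atTop (𝓝 (0 * osc (z k))) :=
      (tendsto_pow_atTop_nhds_zero_of_lt_one (by norm_num) (by norm_num)).mul_const _
    rw [zero_mul] at hlim
    obtain ⟨n₀, hn₀⟩ := eventually_atTop.1
      (hlim.eventually_lt_const (show 0 < s₀ / 3000 by positivity))
    refine eventually_atTop.2 ⟨k + n₀, fun t ht => ?_⟩
    have h1 := hgeom (t - k)
    rw [show k + (t - k) = t by omega] at h1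
    have h2 := hn₀ (t - k) (by omega)
    linarith
  by_contra! hcon
  obtain ⟨k, hk⟩ := eventually_atTop.1 (((hzosc.and hbs).and hbB).and
    (hs.eventually_const_lt (show 0.999 * s₀ < s₀ by linarith)))
  set Y : ℕ → ℝ := fun t => ∑ i, p i * (z t + b (t + 1)) i with hY
  have hYz : ∀ t, Y t = ∑ i, p i * z (t + 1) i := fun t => by rw [hz, hp]
  -- Invariance of `p` under `S` makes the stationary mean an exact running sum, unlike the uniform
  -- average.
  have hYstep : ∀ t, Y (t + 1) = Y t + ∑ i, p i * b (t + 2) i := fun t => by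
    rw [hYz t, hY]
    simp only [Pi.add_apply, mul_add, Finset.sum_add_distrib]
  have hpb : ∀ t, k ≤ t → |∑ i, p i * b t i| ≤ B := fun t ht => by
    calc |∑ i, p i * b t i| ≤ ∑ i, |p i * b t i| := Finset.abs_sum_le_sum_abs _ _
      _ ≤ ∑ i, p i * B := Finset.sum_le_sum fun i _ => by
          rw [abs_mul, abs_of_nonneg (hp0 i)]
          exact mul_le_mul_of_nonneg_left ((norm_le_pi_norm (b t) i).trans (hk t ht).1.2) (hp0 i)
      _ = B := by rw [← Finset.sum_mul, hp1, one_mul]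
  have hB0 : 0 ≤ B := (abs_nonneg _).trans (hpb k le_rfl)
  -- Failure at a later time is pulled back to time `t + 2`, where `z` is within `s₀ / 1000` of its
  -- stationary mean `Y (t + 1)`; the uncancelled term `s (t + 2)` gives `0.999 * s₀`.
  have hfail : ∀ t, k ≤ t → |(∑ i, (z t + b (t + 1)) i) / m| + 0.999 * s₀
      < |Y (t + 1)| + s₀ / 1000 := by
    intro t ht
    obtain ⟨t', ht', hlt⟩ := hcon t
    have h1 := norm_le_add_sum_norm hS hz ht'
    have h2 : ∑ j ∈ Finset.Icc (t + 2 + 1) t', ‖b j‖ ≤ ∑ j ∈ Finset.Icc (t + 2 + 1) t', s j :=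
      Finset.sum_le_sum fun j hj => (hk j (by rw [Finset.mem_Icc] at hj; omega)).1.1.2
    have h3 : ∑ j ∈ Finset.Icc (t + 2) t', s j
        = s (t + 2) + ∑ j ∈ Finset.Icc (t + 2 + 1) t', s j := by
      rw [← Finset.sum_insert (by simp)]
      exact Finset.sum_congr (by ext; simp; omega) fun _ _ => rfl
    have h4 := (hk (t + 2) (by omega)).2
    have h5 := norm_le_abs_sum_add_osc (z (t + 2)) p hp0 hp1
    rw [← hYz (t + 1)] at h5
    have h6 := (hk (t + 2) (by omega)).1.1.1
    linarith
  have havg : ∀ t, k ≤ t → |Y t - ∑ i, (p i - 1 / m) * b (t + 1) i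
      - (∑ i, (z t + b (t + 1)) i) / m| ≤ s₀ / 1000 := by
    intro t ht
    have h1 := abs_sum_sub_sum_le_osc (z t) p (fun _ => 1 / m) (c := 1) hp0
      (fun _ => by positivity) hp1 (by simp [hm])
    refine le_trans (le_of_eq ?_) (h1.trans ((one_mul _).trans_le (hk t ht).1.1.1))
    congr 1
    simp only [hY, Pi.add_apply, mul_add, sub_mul, Finset.sum_add_distrib, Finset.sum_sub_distrib,
      ← Finset.mul_sum]
    ring
  -- One step of `Y` accounts for at most `B` of the excess over the uniform average; the bias must
  -- supply the rest.
  have hcase : ∀ t, k ≤ t →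
      (0 ≤ Y (t + 1) → 0.997 * s₀ - B < ∑ i, (p i - 1 / m) * b (t + 1) i) ∧
      (Y (t + 1) ≤ 0 → 0.997 * s₀ - B < ∑ i, -(p i - 1 / m) * b (t + 1) i) := by
    intro t ht
    have h1 := hfail t ht
    have h2 := abs_le.1 (havg t ht)
    have h3 := abs_le.1 (hpb (t + 2) (by omega))
    have h4 := hYstep t
    have h5 := abs_le.1 (le_refl |(∑ i, (z t + b (t + 1)) i) / m|)
    constructor
    · intro h
      rw [abs_of_nonneg h] at h1
      linarith
    · intro h
      rw [abs_of_nonpos h] at h1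
      simp only [neg_mul, Finset.sum_neg_distrib]
      linarith
  have hlarge : ∀ t, k ≤ t → 0.998 * s₀ < |Y (t + 1)| := fun t ht => by
    have := abs_nonneg ((∑ i, (z t + b (t + 1)) i) / m)
    linarith [hfail t ht]
  -- A change of sign would need a jump above `1.996 * s₀`, but steps are at most `B < s₀`.
  have hsign : (∀ t, k ≤ t → 0 ≤ Y (t + 1)) ∨ (∀ t, k ≤ t → Y (t + 1) ≤ 0) := by
    rcases le_total 0 (Y (k + 1)) with h | h
    · refine Or.inl fun t ht => ?_
      induction t, ht using Nat.le_induction with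
      | base => exact h
      | succ t ht ih =>
        by_contra! hlt
        have h1 := hlarge t ht
        have h2 := hlarge (t + 1) (by omega)
        rw [abs_of_nonneg ih] at h1
        rw [abs_of_neg hlt] at h2
        have h3 := abs_le.1 (hpb (t + 1 + 2) (by omega))
        linarith [hYstep (t + 1)]
    · refine Or.inr fun t ht => ?_
      induction t, ht using Nat.le_induction with
      | base => exact h
      | succ t ht ih =>
        by_contra! hlt
        have h1 := hlarge t ht
        have h2 := hlarge (t + 1) (by omega)
        rw [abs_of_nonpos ih] at h1
        rw [abs_of_pos hlt] at h2
        have h3 := abs_le.1 (hpb (t + 1 + 2) (by omega))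
        linarith [hYstep (t + 1)]
  rcases hsign with h | h
  · obtain ⟨t, ht, hlt⟩ := frequently_atTop.1 hpos (k + 1)
    obtain ⟨t, rfl⟩ : ∃ t', t = t' + 1 := ⟨t - 1, by omega⟩
    exact absurd hlt (not_lt.2 ((hcase t (by omega)).1 (h t (by omega))).le)
  · obtain ⟨t, ht, hlt⟩ := frequently_atTop.1 hneg (k + 1)
    obtain ⟨t, rfl⟩ : ∃ t', t = t' + 1 := ⟨t - 1, by omega⟩
    exact absurd hlt (not_lt.2 ((hcase t (by omega)).2 (h t (by omega))).le)

end Dynamics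

/-! ### From the recursion to the stated bound, and the numerical margin. -/

section Path

open Filter Topology

variable {V : Type*} [Fintype V] [DecidableEq V]

/-- The clipped sample of every agent at time `t`, centred at `μ`. -/
def centredSample (η δ : ℝ) (o : V) (xc yc : V → ℕ → ℝ) (μ : ℝ) (t : ℕ) (i : V) : ℝ :=
  trim (lowerTrim η δ (yc o) t) (upperTrim η δ (yc o) t) (xc i t) - μ

/-- The error of the estimates at the end of time step `t`, multiplied by `t`. -/
def scaledError (G : SimpleGraph V) [DecidableRel G.Adj] (K : ℕ) (η δ : ℝ) (o : V)
    (xc yc : V → ℕ → ℝ) (μ : ℝ) (t : ℕ) (i : V) : ℝ :=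
  t * (estimate G K η δ o xc yc t i - μ)

variable (G : SimpleGraph V) [DecidableRel G.Adj] (K : ℕ) (η δ : ℝ) (o : V)
  (xc yc : V → ℕ → ℝ) (μ : ℝ)

theorem localUpdate_sub (t : ℕ) (i : V) :
    ((t + 1 : ℕ) : ℝ) * (localUpdate η δ o xc yc (t + 1) (estimate G K η δ o xc yc t) i - μ)
      = (scaledError G K η δ o xc yc μ t + centredSample η δ o xc yc μ (t + 1)) i := by
  have : ((t + 1 : ℕ) : ℝ) ≠ 0 := by positivity
  simp only [localUpdate, scaledError, centredSample, Pi.add_apply]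
  field_simp
  push_cast; ring

theorem scaledError_succ (t : ℕ) :
    scaledError G K η δ o xc yc μ (t + 1) = (perronMatrix G ^ K).mulVec
      (scaledError G K η δ o xc yc μ t + centredSample η δ o xc yc μ (t + 1)) := by
  have hS := (isStochastic_perronMatrix G).pow K
  ext i
  rw [scaledError, estimate, commRound_iterate]
  simp only [Matrix.mulVec, dotProduct]
  have h : μ = ∑ j, (perronMatrix G ^ K) i j * μ := by
    rw [← Finset.sum_mul, hS.row_sum, one_mul]
  conv_lhs => rw [h]
  rw [← Finset.sum_sub_distrib, Finset.mul_sum]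
  refine Finset.sum_congr rfl fun j _ => ?_
  rw [← localUpdate_sub]; ring

theorem groupDecision_sub [Nonempty V] (t : ℕ) :
    ((t + 1 : ℕ) : ℝ) * (groupDecision G K η δ o xc yc (t + 1) - μ)
      = (∑ i, (scaledError G K η δ o xc yc μ t + centredSample η δ o xc yc μ (t + 1)) i)
        / Fintype.card V := by
  have hc : (Fintype.card V : ℝ) ≠ 0 := by exact_mod_cast Fintype.card_ne_zero
  simp_rw [← localUpdate_sub]
  rw [← Finset.mul_sum, Finset.sum_sub_distrib, groupDecision]
  simp only [Finset.sum_const, Finset.card_univ, nsmul_eq_mul, Nat.add_sub_cancel]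
  field_simp

variable {G K η δ o xc yc μ}

theorem bound_of_norm_le [Nonempty V] {M C : ℝ} (hM : 0 ≤ M) {s A : ℕ → ℝ} (hA : ∀ j, 0 ≤ A j)
    {t₀ : ℕ} (hC : C = 0 ∨ 1 ≤ M ∧ C = 2 * M * A (t₀ + 2))
    (H : ∀ t, t₀ + 2 ≤ t → ‖scaledError G K η δ o xc yc μ t‖
      ≤ |(∑ i, (scaledError G K η δ o xc yc μ t₀ + centredSample η δ o xc yc μ (t₀ + 1)) i)
          / Fintype.card V| + ∑ j ∈ Finset.Icc (t₀ + 2) t, s j + C) :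
    ∃ tb : ℕ, 1 ≤ tb ∧ ∀ t : ℕ, tb + 1 ≤ t → ∀ i : V,
      |estimate G K η δ o xc yc t i - μ|
        ≤ M ^ (t - tb) * |estimate G K η δ o xc yc tb i - groupDecision G K η δ o xc yc tb|
          + ∑ j ∈ Finset.Icc (tb + 1) t, M ^ (t + 1 - j) * (2 * A j / (j : ℝ))
          + (tb : ℝ) / (t : ℝ) * |groupDecision G K η δ o xc yc tb - μ|
          + 1 / (t : ℝ) * ∑ j ∈ Finset.Icc (tb + 1) t, s j := by
  refine ⟨t₀ + 1, by omega, fun t ht i => ?_⟩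
  have ht0 : (0 : ℝ) < t := by exact_mod_cast (by omega : 0 < t)
  have h1 := (norm_le_pi_norm (scaledError G K η δ o xc yc μ t) i).trans (H t ht)
  rw [← groupDecision_sub, abs_mul, Nat.abs_cast, scaledError, norm_mul, Real.norm_natCast,
    Real.norm_eq_abs] at h1
  have h2 : C / t ≤ ∑ j ∈ Finset.Icc (t₀ + 2) t, M ^ (t + 1 - j) * (2 * A j / (j : ℝ)) := by
    have hn : ∀ j ∈ Finset.Icc (t₀ + 2) t, 0 ≤ M ^ (t + 1 - j) * (2 * A j / (j : ℝ)) :=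
      fun j _ => mul_nonneg (pow_nonneg hM _)
        (div_nonneg (mul_nonneg zero_le_two (hA j)) (Nat.cast_nonneg _))
    rcases hC with rfl | ⟨hM1, rfl⟩
    · rw [zero_div]; exact Finset.sum_nonneg hn
    -- The first summand, `j = t₀ + 2`, pays for `C`: its exponent is at least `1`, `M ≥ 1`, and `j
    -- ≤ t`.
    · refine le_trans ?_ (Finset.single_le_sum hn (Finset.mem_Icc.2 ⟨le_rfl, ht⟩))
      have e : 2 * M * A (t₀ + 2) / t = M * (2 * A (t₀ + 2) / t) := by ring
      rw [e]
      have hA' := hA (t₀ + 2)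
      refine mul_le_mul (le_self_pow₀ hM1 (by omega)) ?_ (by positivity) (by positivity)
      exact div_le_div_of_nonneg_left (by positivity) (by positivity) (by exact_mod_cast ht)
  have h3 : 0 ≤ M ^ (t - (t₀ + 1)) * |estimate G K η δ o xc yc (t₀ + 1) i
      - groupDecision G K η δ o xc yc (t₀ + 1)| := mul_nonneg (pow_nonneg hM _) (abs_nonneg _)
  have h4 : |estimate G K η δ o xc yc t i - μ|
      ≤ ((t₀ + 1 : ℕ) * |groupDecision G K η δ o xc yc (t₀ + 1) - μ|
        + ∑ j ∈ Finset.Icc (t₀ + 2) t, s j + C) / t := by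
    rw [le_div_iff₀ ht0, mul_comm]; exact h1
  have h5 : ((t₀ + 1 : ℕ) * |groupDecision G K η δ o xc yc (t₀ + 1) - μ|
        + ∑ j ∈ Finset.Icc (t₀ + 2) t, s j + C) / t
      = ((t₀ + 1 : ℕ) : ℝ) / t * |groupDecision G K η δ o xc yc (t₀ + 1) - μ|
        + 1 / t * ∑ j ∈ Finset.Icc (t₀ + 2) t, s j + C / t := by ring
  rw [h5] at h4
  have h6 : t₀ + 1 + 1 = t₀ + 2 := rfl
  rw [h6]
  linarith

/-- Each agent accumulates its own samples. Its error at the starting time splits through the group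
decision, and a power of `M ≥ 1` covers the disagreement. -/
theorem bound_of_no_communication [Nonempty V] {M : ℝ} (hM : 1 ≤ M) {s A : ℕ → ℝ}
    (hA : ∀ j, 0 ≤ A j) (hs : ∀ᶠ t in atTop, ‖centredSample η δ o xc yc μ t‖ ≤ s t) :
    ∃ tb : ℕ, 1 ≤ tb ∧ ∀ t : ℕ, tb + 1 ≤ t → ∀ i : V,
      |estimate G 0 η δ o xc yc t i - μ|
        ≤ M ^ (t - tb) * |estimate G 0 η δ o xc yc tb i - groupDecision G 0 η δ o xc yc tb|
          + ∑ j ∈ Finset.Icc (tb + 1) t, M ^ (t + 1 - j) * (2 * A j / (j : ℝ))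
          + (tb : ℝ) / (t : ℝ) * |groupDecision G 0 η δ o xc yc tb - μ|
          + 1 / (t : ℝ) * ∑ j ∈ Finset.Icc (tb + 1) t, s j := by
  obtain ⟨k, hk⟩ := eventually_atTop.1 hs
  refine ⟨k + 1, by omega, fun t ht i => ?_⟩
  have ht0 : (0 : ℝ) < t := by exact_mod_cast (by omega : 0 < t)
  have hz : ∀ t, scaledError G 0 η δ o xc yc μ (t + 1) i
      = scaledError G 0 η δ o xc yc μ t i + centredSample η δ o xc yc μ (t + 1) i := fun t => by
    rw [scaledError_succ]; simp
  have h1 : ∀ t, k + 1 ≤ t → |scaledError G 0 η δ o xc yc μ t i|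
      ≤ |scaledError G 0 η δ o xc yc μ (k + 1) i| + ∑ j ∈ Finset.Icc (k + 1 + 1) t, s j := by
    intro t ht
    induction t, ht using Nat.le_induction with
    | base => simp
    | succ t ht ih =>
      rw [hz, Finset.sum_Icc_succ_top (by omega), ← add_assoc]
      exact (abs_add_le _ _).trans (add_le_add ih
        ((norm_le_pi_norm (centredSample η δ o xc yc μ (t + 1)) i).trans (hk _ (by omega))))
  have h2 := h1 t (by omega)
  simp only [scaledError, abs_mul, Nat.abs_cast] at h2
  set e := |estimate G 0 η δ o xc yc (k + 1) i - groupDecision G 0 η δ o xc yc (k + 1)| with he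
  have h3 : |estimate G 0 η δ o xc yc (k + 1) i - μ|
      ≤ e + |groupDecision G 0 η δ o xc yc (k + 1) - μ| := abs_sub_le _ _ _
  have hr : ((k + 1 : ℕ) : ℝ) / t ≤ 1 := by
    rw [div_le_one ht0]; exact_mod_cast (by omega)
  have h4 : |estimate G 0 η δ o xc yc t i - μ|
      ≤ ((k + 1 : ℕ) : ℝ) / t * |estimate G 0 η δ o xc yc (k + 1) i - μ|
        + 1 / t * ∑ j ∈ Finset.Icc (k + 1 + 1) t, s j := by
    have : |estimate G 0 η δ o xc yc t i - μ| ≤ ((k + 1 : ℕ)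
        * |estimate G 0 η δ o xc yc (k + 1) i - μ| + ∑ j ∈ Finset.Icc (k + 1 + 1) t, s j) / t := by
      rw [le_div_iff₀ ht0, mul_comm]; exact h2
    refine this.trans (le_of_eq ?_)
    ring
  have h5 : ((k + 1 : ℕ) : ℝ) / t * |estimate G 0 η δ o xc yc (k + 1) i - μ|
      ≤ e + ((k + 1 : ℕ) : ℝ) / t * |groupDecision G 0 η δ o xc yc (k + 1) - μ| := by
    have h6 := mul_le_mul_of_nonneg_left h3 (show 0 ≤ ((k + 1 : ℕ) : ℝ) / t by positivity)
    have h7 := mul_le_of_le_one_left (abs_nonneg _ : 0 ≤ e) hr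
    rw [mul_add] at h6
    linarith
  have h6 : e ≤ M ^ (t - (k + 1)) * e := le_mul_of_one_le_left (abs_nonneg _) (one_le_pow₀ hM)
  have h7 : 0 ≤ ∑ j ∈ Finset.Icc (k + 1 + 1) t, M ^ (t + 1 - j) * (2 * A j / (j : ℝ)) :=
    Finset.sum_nonneg fun j _ => mul_nonneg (pow_nonneg (by linarith) _)
      (div_nonneg (mul_nonneg zero_le_two (hA j)) (Nat.cast_nonneg _))
  linarith

theorem osc_centredSample_le {t : ℕ}
    (h : lowerTrim η δ (yc o) t ≤ upperTrim η δ (yc o) t) :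
    osc (centredSample η δ o xc yc μ t)
      ≤ 2 * max |lowerTrim η δ (yc o) t| |upperTrim η δ (yc o) t| := by
  refine osc_le (mul_nonneg zero_le_two (le_max_of_le_left (abs_nonneg _))) fun i j => ?_
  obtain ⟨h1, h2⟩ := trim_mem_Icc h (xc i t)
  obtain ⟨h3, h4⟩ := trim_mem_Icc h (xc j t)
  have h5 := (neg_abs_le _).trans h1
  have h6 := (neg_abs_le _).trans h3
  have h7 := le_max_left |lowerTrim η δ (yc o) t| |upperTrim η δ (yc o) t|
  have h8 := le_max_right |lowerTrim η δ (yc o) t| |upperTrim η δ (yc o) t|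
  have h9 := le_abs_self (upperTrim η δ (yc o) t)
  rw [abs_le, centredSample, centredSample]
  constructor <;> linarith

theorem norm_centredSample_le {a b : ℝ} {t : ℕ} (h1 : a ≤ lowerTrim η δ (yc o) t)
    (h2 : lowerTrim η δ (yc o) t ≤ upperTrim η δ (yc o) t) (h3 : upperTrim η δ (yc o) t ≤ b)
    {B : ℝ} (hB : 0 ≤ B) (ha : μ - a ≤ B) (hb : b - μ ≤ B) :
    ‖centredSample η δ o xc yc μ t‖ ≤ B := by
  refine (pi_norm_le_iff_of_nonneg hB).2 fun i => ?_
  obtain ⟨h4, h5⟩ := trim_mem_Icc h2 (xc i t)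
  rw [Real.norm_eq_abs, abs_le, centredSample]
  constructor <;> linarith

/-- Here `σ` is the variance, `s₀` the limiting radius, and `ν`, `g` stand for the `ℓ²` and `ℓ¹`
norms of the bias. The left side is the expected gain plus the corruption budget. The constants
round up `√(4/5.95)`, `√(8/5.95)` and `1/√3`. -/
theorem trimming_margin {η σ s₀ U L ν g : ℝ} (hη : 0 < η) (hη' : η < 1 / 16) (hs : 0 < s₀)
    (hσ : σ = 4 * η * s₀ ^ 2) (hU : 0 ≤ U) (hL : 0 ≤ L)
    (h1 : 5.95 * η * U ^ 2 ≤ σ * (1 - 5.95 * η)) (h2 : 5.95 * η * L ^ 2 ≤ σ * (1 - 5.95 * η))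
    (h3 : 5.95 * η * (U ^ 2 + L ^ 2) ≤ σ) (hν : 0 ≤ ν) (hν2 : ν ^ 2 ≤ 1 / 3) (hg0 : 0 ≤ g)
    (hg : g ≤ 2 * (1 - 2 * ν ^ 2)) :
    ν / 4 * (U + L) + 2 * η * g * (U + L) < 0.997 * s₀ - max U L := by
  have key : ∀ T : ℝ, 0 ≤ T → 5.95 * η * T ^ 2 ≤ σ * (1 - 5.95 * η) →
      T ≤ 0.82 * (1 - 2.975 * η) * s₀ := by
    intro T hT h
    have h' : 5.95 * T ^ 2 ≤ 4 * s₀ ^ 2 * (1 - 5.95 * η) := by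
      refine le_of_mul_le_mul_left ?_ hη
      rw [hσ] at h; linarith
    refine le_of_sq_le_sq ?_ (mul_nonneg (by linarith) hs.le)
    have hq : 0 ≤ s₀ ^ 2 := sq_nonneg _
    have hq1 : 0 ≤ s₀ ^ 2 * (1 - 5.95 * η) := mul_nonneg hq (by linarith)
    have hq2 : 0 ≤ s₀ ^ 2 * η ^ 2 := mul_nonneg hq (sq_nonneg _)
    nlinarith
  have hmax : max U L ≤ 0.82 * (1 - 2.975 * η) * s₀ := max_le (key U hU h1) (key L hL h2)
  have hw : U + L ≤ 1.16 * s₀ := by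
    have h' : 5.95 * (U ^ 2 + L ^ 2) ≤ 4 * s₀ ^ 2 := by
      refine le_of_mul_le_mul_left ?_ hη
      rw [hσ] at h3; linarith
    refine le_of_sq_le_sq ?_ (by linarith)
    nlinarith [sq_nonneg (U - L), sq_nonneg s₀]
  have hν1 : ν ≤ 0.578 := le_of_sq_le_sq (by norm_num; linarith) (by norm_num)
  have hc : ν / 4 + 2 * η * g ≤ ν / 4 + 4 * η * (1 - 2 * ν ^ 2) := by nlinarith
  have hc0 : 0 ≤ ν / 4 + 2 * η * g := by positivity
  have h4 : ν / 4 * (U + L) + 2 * η * g * (U + L)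
      ≤ (ν / 4 + 4 * η * (1 - 2 * ν ^ 2)) * (1.16 * s₀) := by
    rw [← add_mul]
    exact mul_le_mul hc hw (by positivity) (hc0.trans hc)
  have h5 : 0.82 * (1 - 2.975 * η) + (ν / 4 + 4 * η * (1 - 2 * ν ^ 2)) * 1.16 < 0.997 := by
    -- The expression is affine in `η`, so only the endpoints `0` and `1/16` need checking.
    have e : 0.82 * (1 - 2.975 * η) + (ν / 4 + 4 * η * (1 - 2 * ν ^ 2)) * 1.16
        = (1 - 16 * η) * (0.82 + 0.29 * ν)
          + 16 * η * (0.82 * (1 - 0.1859375) + 0.29 * (1 + ν - 2 * ν ^ 2)) := by ring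
    have h6 : 0.82 + 0.29 * ν ≤ 0.995 := by linarith
    have h7 : 0.82 * (1 - 0.1859375) + 0.29 * (1 + ν - 2 * ν ^ 2) ≤ 0.995 := by
      nlinarith [sq_nonneg (ν - 1 / 4)]
    rw [e]
    nlinarith
  have h8 := mul_lt_mul_of_pos_right h5 hs
  linarith

end Path

/-! ### Typical paths, the choice of the constant, and the almost sure statement. -/

section Main

open Filter Topology

variable {V : Type*} [Fintype V] [DecidableEq V] {G : SimpleGraph V} [DecidableRel G.Adj]

/-- What the proof needs to know about one path of samples: `x, y` are the true streams, `v` is the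
variance, and `[μ - L, μ + U]` is an interval which eventually contains the trimming values. -/
structure IsTypicalPath (G : SimpleGraph V) [DecidableRel G.Adj] (η v μ U L : ℝ)
    (x y : V → ℕ → ℝ) : Prop where
  card_lower : ∀ i, ∀ᶠ t : ℕ in atTop,
    (((Finset.Icc 1 t).filter fun j => y i j < μ - L).card : ℝ) < 6 * η * t
  card_upper : ∀ i, ∀ᶠ t : ℕ in atTop,
    (((Finset.Icc 1 t).filter fun j => μ + U < y i j).card : ℝ) < 6 * η * t
  average : ∀ g : V → ℝ, (g = bias G ∨ g = -bias G) →
    ∃ E ≤ √(∑ i, bias G i ^ 2) / 4 * (U + L),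
      Tendsto (fun n : ℕ => (∑ j ∈ Finset.range n,
        trimGain g (μ - L) (μ + U) fun i => x i (j + 1)) / n) atTop (𝓝 E)

/-- Bounds satisfied by the quantile interval `[μ - L, μ + U]` at level `5.95 η`. -/
structure IsQuantileInterval (η v U L : ℝ) : Prop where
  upper_nonneg : 0 ≤ U
  lower_nonneg : 0 ≤ L
  upper : 5.95 * η * U ^ 2 ≤ v * (1 - 5.95 * η)
  lower : 5.95 * η * L ^ 2 ≤ v * (1 - 5.95 * η)
  both : 5.95 * η * (U ^ 2 + L ^ 2) ≤ v

theorem tendsto_chebyshev_radius {η : ℝ} (hη : 0 < η) (v c : ℝ) :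
    Tendsto (fun j : ℕ => √v / √(4 * η + 6 * (c / (j : ℝ)))) atTop (𝓝 (√v / √(4 * η))) := by
  have h1 : Tendsto (fun j : ℕ => 4 * η + 6 * (c / (j : ℝ))) atTop (𝓝 (4 * η + 6 * 0)) :=
    ((tendsto_const_div_atTop_nhds_zero_nat c).const_mul 6).const_add _
  rw [mul_zero, add_zero] at h1
  exact tendsto_const_nhds.div h1.sqrt (Real.sqrt_pos.2 (by positivity)).ne'

theorem chebyshev_radius_sq {η v : ℝ} (hη : 0 < η) (hv : 0 ≤ v) :
    v = 4 * η * (√v / √(4 * η)) ^ 2 := by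
  rw [div_pow, Real.sq_sqrt hv, Real.sq_sqrt (by positivity)]
  field_simp

theorem perronMatrix_pow_mulVec_of_complete (h : ∀ i j, i ≠ j → G.Adj i j) (k : ℕ) (v : V → ℝ)
    (i : V) : (perronMatrix G ^ (k + 1)).mulVec v i = (∑ j, v j) / Fintype.card V := by
  rw [pow_succ, ← Matrix.mulVec_mulVec]
  have : (perronMatrix G).mulVec v = fun _ => (∑ j, v j) / (Fintype.card V : ℝ) :=
    funext fun i => commRound_of_complete h v i
  rw [this]
  simp only [Matrix.mulVec, dotProduct]
  rw [← Finset.sum_mul, ((isStochastic_perronMatrix G).pow k).row_sum, one_mul]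

section TypicalPath

variable {K : ℕ} {η δ v μ U L : ℝ} {o : V} {x y xc yc : V → ℕ → ℝ}

theorem IsTypicalPath.eventually_trim (hx : IsTypicalPath G η v μ U L x y)
    (hη : 0 < η) (hη' : η < 1 / 16) (hδ : 0 < δ) (hδ' : δ < 1)
    (hc : IsCorruption η (x o) (y o) (xc o) (yc o)) :
    ∀ᶠ t : ℕ in atTop, μ - L ≤ lowerTrim η δ (yc o) t ∧
      lowerTrim η δ (yc o) t ≤ upperTrim η δ (yc o) t ∧ upperTrim η δ (yc o) t ≤ μ + U :=
  eventually_trim_mem hδ hδ' hη hη' hc (hx.card_lower o) (hx.card_upper o)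

theorem IsTypicalPath.eventually_norm_le (hx : IsTypicalPath G η v μ U L x y)
    (hη : 0 < η) (hη' : η < 1 / 16) (hδ : 0 < δ) (hδ' : δ < 1)
    (hc : IsCorruption η (x o) (y o) (xc o) (yc o)) (hq : IsQuantileInterval η v U L) :
    ∀ᶠ t : ℕ in atTop, ‖centredSample η δ o xc yc μ t‖ ≤ max U L := by
  filter_upwards [hx.eventually_trim hη hη' hδ hδ' hc] with t ht
  exact norm_centredSample_le ht.1 ht.2.1 ht.2.2 (le_max_of_le_left hq.upper_nonneg)
    (by linarith [le_max_right U L]) (by linarith [le_max_left U L])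

theorem IsQuantileInterval.max_lt (hq : IsQuantileInterval η v U L) (hη : 0 < η)
    (hη' : η < 1 / 16) (hv : 0 < v) : max U L < √v / √(4 * η) := by
  have hs : 0 < √v / √(4 * η) := div_pos (Real.sqrt_pos.2 hv) (Real.sqrt_pos.2 (by positivity))
  have h := trimming_margin (ν := 0) (g := 0) hη hη' hs (chebyshev_radius_sq hη hv.le)
    hq.upper_nonneg hq.lower_nonneg hq.upper hq.lower hq.both le_rfl (by norm_num) le_rfl
    (by norm_num)
  simp only [zero_div, zero_mul, mul_zero, add_zero] at h
  linarith

theorem IsTypicalPath.eventually_norm_add_le (hx : IsTypicalPath G η v μ U L x y)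
    (hη : 0 < η) (hη' : η < 1 / 16) (hδ : 0 < δ) (hδ' : δ < 1)
    (hc : IsCorruption η (x o) (y o) (xc o) (yc o)) (hq : IsQuantileInterval η v U L)
    (hv : 0 < v) : ∃ ε > 0, ∀ᶠ t : ℕ in atTop, ‖centredSample η δ o xc yc μ t‖ + ε
      ≤ √v / √(4 * η + 6 * (Real.log (4 / δ) / (t : ℝ))) := by
  have hB := hq.max_lt hη hη' hv
  refine ⟨(√v / √(4 * η) - max U L) / 2, by linarith, ?_⟩
  filter_upwards [hx.eventually_norm_le hη hη' hδ hδ' hc hq,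
    (tendsto_chebyshev_radius hη v (Real.log (4 / δ))).eventually_const_lt
      (show (√v / √(4 * η) + max U L) / 2 < √v / √(4 * η) by linarith)] with t h1 h2
  linarith

/-- Centring is invisible to zero-sum weights, so the law of large numbers for trimmed samples
applies, and `trimming_margin` makes its threshold small enough. -/
theorem IsTypicalPath.frequently_lt [Nonempty V] (hx : IsTypicalPath G η v μ U L x y)
    (hη : 0 < η) (hη' : η < 1 / 16) (hδ : 0 < δ) (hδ' : δ < 1)
    (hc : ∀ i, IsCorruption η (x i) (y i) (xc i) (yc i)) (hq : IsQuantileInterval η v U L)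
    (hv : 0 < v) (hG : G.Connected) (hV : 2 ≤ Fintype.card V) {g : V → ℝ}
    (hg : g = bias G ∨ g = -bias G) :
    ∃ᶠ t : ℕ in atTop, ∑ i, g i * centredSample η δ o xc yc μ t i
      < 0.997 * (√v / √(4 * η)) - max U L := by
  have hs : 0 < √v / √(4 * η) := div_pos (Real.sqrt_pos.2 hv) (Real.sqrt_pos.2 (by positivity))
  obtain ⟨E, hE, hlim⟩ := hx.average g hg
  have hg0 : ∑ i, g i = 0 := by
    rcases hg with rfl | rfl <;> simp [sum_bias]
  have hgabs : ∑ i, |g i| = ∑ i, |bias G i| := by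
    rcases hg with rfl | rfl <;> simp
  obtain ⟨hb1, hb2⟩ := bias_bounds hG hV
  have hsq : √(∑ i, bias G i ^ 2) ^ 2 = ∑ i, bias G i ^ 2 :=
    Real.sq_sqrt (Finset.sum_nonneg fun i _ => sq_nonneg _)
  rw [← hsq] at hb1 hb2
  have hm := trimming_margin hη hη' hs (chebyshev_radius_sq hη hv.le)
    hq.upper_nonneg hq.lower_nonneg hq.upper hq.lower hq.both (Real.sqrt_nonneg _) hb1
    (Finset.sum_nonneg fun i _ => abs_nonneg _) hb2
  have hfreq := frequently_sum_mul_trim_lt hg0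
    (by linarith [hq.upper_nonneg, hq.lower_nonneg] : μ - L ≤ μ + U) hc
    (hx.eventually_trim hη hη' hδ hδ' (hc o)) hlim
    (ζ := 0.997 * (√v / √(4 * η)) - max U L) (by
      rw [hgabs, show μ + U - (μ - L) = U + L by ring]
      linarith)
  refine hfreq.mono fun t ht => lt_of_eq_of_lt ?_ ht
  simp only [centredSample, mul_sub, Finset.sum_sub_distrib]
  rw [← Finset.sum_mul, hg0, zero_mul, sub_zero]

end TypicalPath

theorem exists_estimate_bound (hG : G.Connected) : ∃ c : ℝ, 0 < c ∧
    ∀ (K : ℕ) (η δ : ℝ), 0 < η → η < 1 / 16 → 0 < δ → δ < 1 →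
    ∀ (v μ U L : ℝ) (o : V) (x y xc yc : V → ℕ → ℝ), 0 < v → IsQuantileInterval η v U L →
      IsTypicalPath G η v μ U L x y → (∀ i, IsCorruption η (x i) (y i) (xc i) (yc i)) →
      ∃ tb : ℕ, 1 ≤ tb ∧ ∀ t : ℕ, tb + 1 ≤ t → ∀ i : V,
        |estimate G K η δ o xc yc t i - μ|
          ≤ (c * secondEigenvalue G ^ K) ^ (t - tb)
                * |estimate G K η δ o xc yc tb i - groupDecision G K η δ o xc yc tb|
            + ∑ j ∈ Finset.Icc (tb + 1) t, (c * secondEigenvalue G ^ K) ^ (t + 1 - j)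
                * (2 * max |lowerTrim η δ (yc o) j| |upperTrim η δ (yc o) j| / (j : ℝ))
            + (tb : ℝ) / (t : ℝ) * |groupDecision G K η δ o xc yc tb - μ|
            + 1 / (t : ℝ) * ∑ j ∈ Finset.Icc (tb + 1) t,
                √v / √(4 * η + 6 * (Real.log (4 / δ) / (j : ℝ))) := by
  have := hG.nonempty
  have hA : ∀ η δ (y : ℕ → ℝ) j, 0 ≤ max |lowerTrim η δ y j| |upperTrim η δ y j| :=
    fun _ _ _ _ => le_max_of_le_left (abs_nonneg _)
  have hW := isStochastic_perronMatrix G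
  by_cases hcomp : ∀ i j, i ≠ j → G.Adj i j
  · refine ⟨1, one_pos, fun K η δ hη hη' hδ hδ' v μ U L o x y xc yc hv hq hx hc => ?_⟩
    obtain ⟨ε, hε, hbs⟩ := hx.eventually_norm_add_le hη hη' hδ hδ' (hc o) hq hv
    have hbs' := hbs.mono fun t ht => (le_add_of_nonneg_right hε.le).trans ht
    rcases Nat.eq_zero_or_pos K with rfl | hK
    · exact bound_of_no_communication (by simp) (hA η δ (yc o)) hbs'
    · obtain ⟨K, rfl⟩ : ∃ k, K = k + 1 := ⟨K - 1, by omega⟩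
      obtain ⟨k, hk⟩ := eventually_atTop.1 hbs'
      refine bound_of_norm_le
        (mul_nonneg zero_le_one (pow_nonneg (secondEigenvalue_nonneg_of_complete hG hcomp) _))
        (hA η δ (yc o)) (t₀ := k) (Or.inl rfl) fun t ht => ?_
      rw [add_zero]
      refine (norm_le_add_sum_norm (hW.pow (K + 1)) (scaledError_succ G (K + 1) η δ o xc yc μ)
        (show k + 1 ≤ t by omega)).trans (add_le_add ?_ (Finset.sum_le_sum fun j hj => hk j ?_))
      · refine (pi_norm_le_iff_of_nonneg (abs_nonneg _)).2 fun i => ?_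
        rw [scaledError_succ, perronMatrix_pow_mulVec_of_complete hcomp, Real.norm_eq_abs]
      · rw [Finset.mem_Icc] at hj; omega
  · push Not at hcomp
    obtain ⟨p, q, hpq, hadj⟩ := hcomp
    have hV : 2 ≤ Fintype.card V := Fintype.one_lt_card_iff.2 ⟨p, q, hpq⟩
    have hl := secondEigenvalue_pos hG hpq hadj
    obtain ⟨N, r, hN, hr0, hr1, hr⟩ := exists_accOsc_contraction hG
    have hlim : Tendsto (fun K : ℕ => N * r ^ K) atTop (𝓝 (N * 0)) :=
      (tendsto_pow_atTop_nhds_zero_of_lt_one hr0.le hr1).const_mul _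
    rw [mul_zero] at hlim
    obtain ⟨K₀, hK₀⟩ := eventually_atTop.1
      (hlim.eventually_le_const (show (0 : ℝ) < 1 / 4000 by norm_num))
    set M := max 1 (2 * N / (1 - r)) with hM
    have hM0 : 0 < M := lt_of_lt_of_le one_pos (le_max_left _ _)
    have hinv : ∀ k, 0 < (secondEigenvalue G)⁻¹ ^ k := fun k => pow_pos (inv_pos.2 hl) k
    -- The sum dominates each `λ⁻ᵏ` with `k ≤ K₀`, hence `c λ^K ≥ M` for all `K ≤ K₀`; `M` and `K₀`
    -- depend on the graph only.
    refine ⟨M * ∑ k ∈ Finset.range (K₀ + 1), (secondEigenvalue G)⁻¹ ^ k,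
      mul_pos hM0 (Finset.sum_pos (fun k _ => hinv k) (by simp)),
      fun K η δ hη hη' hδ hδ' v μ U L o x y xc yc hv hq hx hc => ?_⟩
    set c := M * ∑ k ∈ Finset.range (K₀ + 1), (secondEigenvalue G)⁻¹ ^ k with hcdef
    have hc0 : 0 ≤ c := mul_nonneg hM0.le (Finset.sum_nonneg fun k _ => (hinv k).le)
    have hcK0 : 0 ≤ c * secondEigenvalue G ^ K := mul_nonneg hc0 (pow_nonneg hl.le _)
    have hcK : K ≤ K₀ → M ≤ c * secondEigenvalue G ^ K := fun hK => by
      have h1 : (secondEigenvalue G)⁻¹ ^ K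
          ≤ ∑ k ∈ Finset.range (K₀ + 1), (secondEigenvalue G)⁻¹ ^ k :=
        Finset.single_le_sum (f := fun k => (secondEigenvalue G)⁻¹ ^ k)
          (fun k _ => (hinv k).le) (Finset.mem_range.2 (by omega))
      calc M = M * (secondEigenvalue G)⁻¹ ^ K * secondEigenvalue G ^ K := by
            rw [mul_assoc, ← mul_pow, inv_mul_cancel₀ hl.ne', one_pow, mul_one]
        _ ≤ c * secondEigenvalue G ^ K :=
            mul_le_mul_of_nonneg_right (mul_le_mul_of_nonneg_left h1 hM0.le) (pow_nonneg hl.le _)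
    obtain ⟨ε, hε, hbs⟩ := hx.eventually_norm_add_le hη hη' hδ hδ' (hc o) hq hv
    have hbs' := hbs.mono fun t ht => (le_add_of_nonneg_right hε.le).trans ht
    rcases Nat.eq_zero_or_pos K with rfl | hKpos
    · exact bound_of_no_communication ((le_max_left _ _).trans (hcK (Nat.zero_le _)))
        (hA η δ (yc o)) hbs'
    have hS := hW.pow K
    have hO := accOsc_pow_mulVec_le hr0.le hr K
    rcases le_or_gt K K₀ with hK | hK
    · have hO' : ∀ u, accOsc (perronMatrix G) N ((perronMatrix G ^ K).mulVec u)
          ≤ r * accOsc (perronMatrix G) N u := fun u =>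
        (hO u).trans (mul_le_mul_of_nonneg_right
          (pow_le_of_le_one hr0.le hr1.le hKpos.ne') (accOsc_nonneg _ _ _))
      obtain ⟨t₀, ht₀⟩ := exists_norm_le_of_contraction hS hW hN hr0 hr1 hO'
        (scaledError_succ G K η δ o xc yc μ) hε hbs
        ((hx.eventually_trim hη hη' hδ hδ' (hc o)).mono fun t ht => osc_centredSample_le ht.2.1)
        ((le_max_right _ _).trans (hcK hK))
      exact bound_of_norm_le hcK0 (hA η δ (yc o))
        (Or.inr ⟨(le_max_left _ _).trans (hcK hK), rfl⟩) ht₀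
    · have hθ := hK₀ K hK.le
      have hosc : ∀ u, osc ((perronMatrix G ^ K).mulVec u) ≤ N * r ^ K * osc u := fun u => by
        refine (osc_le_accOsc (perronMatrix G) hN _).trans ((hO u).trans ?_)
        have h1 := mul_le_mul_of_nonneg_left (accOsc_le hW N u) (pow_nonneg hr0.le K)
        linarith
      obtain ⟨t₀, ht₀⟩ := exists_norm_le_of_mixing hS (by positivity) hθ hosc
        (fun i => stationary_nonneg (G := G) i) sum_stationary (sum_stationary_pow_mulVec K)
        (scaledError_succ G K η δ o xc yc μ)
        (div_pos (Real.sqrt_pos.2 hv) (Real.sqrt_pos.2 (by positivity)))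
        (tendsto_chebyshev_radius hη v (Real.log (4 / δ))) (hq.max_lt hη hη' hv) hbs'
        (hx.eventually_norm_le hη hη' hδ hδ' (hc o) hq)
        (hx.frequently_lt hη hη' hδ hδ' hc hq hv hG hV (Or.inl rfl))
        (hx.frequently_lt hη hη' hδ hδ' hc hq hv hG hV (Or.inr rfl))
      exact bound_of_norm_le hcK0 (hA η δ (yc o)) (Or.inl rfl) (by simpa using ht₀)

/-- Only finitely many laws of large numbers are used, all about true samples and for every agent,
so the exceptional null set depends neither on the adversary nor on the random agent. -/
theorem ae_isTypicalPath {Ω : Type*} {mΩ : MeasurableSpace Ω} {P : Measure Ω}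
    [IsProbabilityMeasure P] {ρ : Measure ℝ} [IsProbabilityMeasure ρ] (G : SimpleGraph V)
    [DecidableRel G.Adj] [Nonempty V] {x y : Ω → V → ℕ → ℝ}
    (hx : ∀ i t, 1 ≤ t → AEMeasurable (fun ω => x ω i t) P)
    (hy : ∀ i t, 1 ≤ t → AEMeasurable (fun ω => y ω i t) P)
    (hxρ : ∀ i t, 1 ≤ t → P.map (fun ω => x ω i t) = ρ)
    (hyρ : ∀ i t, 1 ≤ t → P.map (fun ω => y ω i t) = ρ)
    (hind : iIndepFun (fun (p : (V × ℕ) ⊕ (V × ℕ)) (ω : Ω) =>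
        Sum.elim (fun q => x ω q.1 (q.2 + 1)) (fun q => y ω q.1 (q.2 + 1)) p) P)
    {η v μ U L : ℝ} (hη : 0 < η) (hU : 0 ≤ U) (hL : 0 ≤ L)
    (hρU : ρ.real (Set.Ioi (μ + U)) ≤ 5.95 * η) (hρL : ρ.real (Set.Iio (μ - L)) ≤ 5.95 * η) :
    ∀ᵐ ω ∂P, IsTypicalPath G η v μ U L (x ω) (y ω) := by
  have hab : μ - L ≤ μ + U := by linarith
  have hy' : ∀ (A : Set ℝ), MeasurableSet A → ∀ i : V, ∀ᵐ ω ∂P, Tendsto (fun n : ℕ =>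
      (∑ j ∈ Finset.range n, A.indicator (fun _ => (1 : ℝ)) (y ω i (j + 1))) / n) atTop
      (𝓝 (ρ.real A)) := by
    intro A hA i
    have h := ae_tendsto_average (P := P) (ν := ρ) (Z := fun j ω => y ω i (j + 1))
      (fun j => hy i (j + 1) (by omega)) (fun j => hyρ i (j + 1) (by omega))
      (fun j k hjk => hind.indepFun (i := Sum.inr (i, j)) (j := Sum.inr (i, k)) (by simpa using hjk))
      (f := A.indicator fun _ => (1 : ℝ)) (measurable_const.indicator hA) (C := 1)
      (fun e => by by_cases he : e ∈ A <;> simp [he])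
    rwa [integral_indicator_const _ hA, smul_eq_mul, mul_one] at h
  have hx' : ∀ g : V → ℝ, ∀ᵐ ω ∂P, Tendsto (fun n : ℕ => (∑ j ∈ Finset.range n,
        trimGain g (μ - L) (μ + U) fun i => x ω i (j + 1)) / n) atTop
        (𝓝 (∫ e, trimGain g (μ - L) (μ + U) e ∂(Measure.pi fun _ : V => ρ))) := fun g =>
    ae_tendsto_average_of_iIndepFun (x := fun q ω => x ω q.1 (q.2 + 1))
      (fun q => hx q.1 (q.2 + 1) (by omega)) (fun q => hxρ q.1 (q.2 + 1) (by omega))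
      (hind.precomp (g := Sum.inl) Sum.inl_injective) (measurable_trimGain g hab)
      (fun e => by
        rw [abs_of_nonneg (trimGain_nonneg g hab e)]
        exact trimGain_le g hab e)
  filter_upwards [ae_all_iff.2 (hy' (Set.Iio (μ - L)) measurableSet_Iio),
    ae_all_iff.2 (hy' (Set.Ioi (μ + U)) measurableSet_Ioi), hx' (bias G), hx' (-bias G)]
    with ω h1 h2 h3 h4
  refine ⟨fun i => ?_, fun i => ?_, ?_⟩
  · classical exact eventually_card_lt (A := Set.Iio (μ - L)) (h1 i) (by linarith)
  · classical exact eventually_card_lt (A := Set.Ioi (μ + U)) (h2 i) (by linarith)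
  · have hw : μ + U - (μ - L) = U + L := by ring
    rintro g (rfl | rfl)
    · exact ⟨_, by simpa only [hw] using integral_trimGain_le (ρ := ρ) (bias G) sum_bias hab, h3⟩
    · refine ⟨_, ?_, h4⟩
      have h := integral_trimGain_le (ρ := ρ) (-bias G) (by simp [sum_bias]) hab
      simpa only [hw, Pi.neg_apply, neg_sq] using h

end Main

end RobustMean

end

theorem theorem4 {V : Type*} [Fintype V] [DecidableEq V] (G : SimpleGraph V)
    [DecidableRel G.Adj] (hG : G.Connected) :
    ∃ c : ℝ, 0 < c ∧
      ∀ (K : ℕ) (η δ : ℝ), 0 < η → η < 1 / 16 → 0 < δ → δ < 1 →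
      ∀ (Ω : Type*) [MeasurableSpace Ω] (P : Measure Ω) [IsProbabilityMeasure P]
        (X : Ω → ℝ) (x y xc yc : Ω → V → ℕ → ℝ) (o : Ω → V),
      -- `X` has finite variance and an absolutely continuous distribution
      MemLp X 2 P → P.map X ≪ volume →
      -- the original samples `x ω i t`, `y ω i t`, for `t ≥ 1`, are i.i.d. copies of `X`
      (∀ (i : V) (t : ℕ), 1 ≤ t → IdentDistrib (fun ω => x ω i t) X P P) →
      (∀ (i : V) (t : ℕ), 1 ≤ t → IdentDistrib (fun ω => y ω i t) X P P) →
      iIndepFun (fun (p : (V × ℕ) ⊕ (V × ℕ)) (ω : Ω) =>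
        Sum.elim (fun q => x ω q.1 (q.2 + 1)) (fun q => y ω q.1 (q.2 + 1)) p) P →
      -- `xc`, `yc` are the corrupted samples that the agents observe
      (∀ (ω : Ω) (i : V), RobustMean.IsCorruption η (x ω i) (y ω i) (xc ω i) (yc ω i)) →
      ∀ᵐ ω ∂P, ∃ tb : ℕ, 1 ≤ tb ∧ ∀ t : ℕ, tb + 1 ≤ t → ∀ i : V,
        |RobustMean.estimate G K η δ (o ω) (xc ω) (yc ω) t i - P[X]|
          ≤ (c * RobustMean.secondEigenvalue G ^ K) ^ (t - tb)
                * |RobustMean.estimate G K η δ (o ω) (xc ω) (yc ω) tb i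
                    - RobustMean.groupDecision G K η δ (o ω) (xc ω) (yc ω) tb|
            + ∑ j ∈ Finset.Icc (tb + 1) t,
                (c * RobustMean.secondEigenvalue G ^ K) ^ (t + 1 - j)
                  * (2 * max |RobustMean.lowerTrim η δ (yc ω (o ω)) j|
                        |RobustMean.upperTrim η δ (yc ω (o ω)) j| / (j : ℝ))
            + (tb : ℝ) / (t : ℝ)
                * |RobustMean.groupDecision G K η δ (o ω) (xc ω) (yc ω) tb - P[X]|
            + 1 / (t : ℝ) * ∑ j ∈ Finset.Icc (tb + 1) t,
                √Var[X; P] / √(4 * η + 6 * (Real.log (4 / δ) / (j : ℝ))) := by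
  have := hG.nonempty
  obtain ⟨c, hc, H⟩ := RobustMean.exists_estimate_bound hG
  refine ⟨c, hc, fun K η δ hη hη' hδ hδ' Ω _ P _ X x y xc yc o hX hac hx hy hind hcor => ?_⟩
  have hXm : AEMeasurable X P := hX.aestronglyMeasurable.aemeasurable
  set ρ := P.map X with hρ
  have : IsProbabilityMeasure ρ := Measure.isProbabilityMeasure_map hXm
  have : NullSingletonClass ρ := ⟨fun a => hac (measure_singleton a)⟩
  have h2 : MemLp id 2 ρ :=
    (memLp_map_measure_iff aestronglyMeasurable_id hXm).2 (by simpa using hX)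
  have hvar : Var[id; ρ] = Var[X; P] := by rw [hρ, variance_id_map hXm]
  have hmean : ∫ t, t ∂ρ = P[X] := integral_map hXm aestronglyMeasurable_id
  -- The level is just below `6η`, leaving room for the strict limit in the law of large numbers.
  obtain ⟨U, L, hU, hL, hρU, hρL, hqU, hqL, hqUL⟩ :=
    RobustMean.exists_quantile_bounds h2 (κ := 5.95 * η) (by linarith) (by linarith)
  have hv : 0 < Var[X; P] := hvar ▸ RobustMean.variance_pos_of_nullSingletonClass h2
  rw [hvar] at hqU hqL hqUL
  rw [hmean] at hρU hρL
  filter_upwards [RobustMean.ae_isTypicalPath (v := Var[X; P]) G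
    (fun i t ht => (hx i t ht).aemeasurable_fst) (fun i t ht => (hy i t ht).aemeasurable_fst)
    (fun i t ht => (hx i t ht).map_eq) (fun i t ht => (hy i t ht).map_eq) hind hη hU hL hρU hρL]
    with ω hω
  exact H K η δ hη hη' hδ hδ' _ _ U L (o ω) (x ω) (y ω) (xc ω) (yc ω) hv
    ⟨hU, hL, hqU, hqL, hqUL⟩ hω (hcor ω)
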